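/- **Setting.** An *extended metric* on a set $X$ is a symmetric $\mathsf d:X\times X\to[0,\infty]$ satisfying the triangle inequality with $\mathsf d(x,y)=0$ iff $x=y$. Given a topology $\tau$, let $\mathrm{Lip}_b(X,\tau,\mathsf d)$ be the set of bounded, $\tau$-continuous, $\mathsf d$-Lipschitz functions $X\to\mathbb R$. $(X,\tau,\mathsf d)$ is an *extended metric-topological space* if $\tau$ is Hausdorff and generated by $\mathrm{Lip}_b(X,\tau,\mathsf d)$, and $\mathsf d(x,y)=\sup|f(x)-f(y)|$ over all $1$-Lipschitz $f\in\mathrm{Lip}_b(X,\tau,\mathsf d)$. An *extended metric measure space* $(X,\mathsf d,\mathfrak m)$ is an extended metric-topological space with $\mathsf d$ complete, together with a non-negative Radon measure $\mathfrak m$ on $\mathcal B(\tau)$ (locally finite, inner regular with respect to compact sets) of full support. $\mathcal P(X)$ is the set of Radon probability measures on $\mathcal B(\tau)$, and $\mathcal P_2(X,\mathsf d)$ the set of those $\mu\in\mathcal P(X)$ with $\int\mathsf d^2(x_0,y)\,d\mu(y)<\infty$ for some $x_0\in X$. Set $W_2^2(\mu,\nu)=\inf_\pi\int\mathsf d^2\,d\pi\in[0,\infty]$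 over Radon probability measures $\pi$ on $X\times X$ with marginals $\mu,\nu$. Let $\mathcal P(X)$ carry a topology $\bar\tau$, finer than or equal to the narrow topology, such that $(\mathcal P(X),\bar\tau,W_2)$ is an extended metric-topological space. For a probability measure $\Omega$ on $\mathcal B(\bar\tau)$ set $\mathrm{Var}(\Omega)=\inf_{\nu\in\mathcal P(X)}\int W_2^2(\mu,\nu)\,d\Omega(\mu)$; a *Wasserstein barycenter* of $\Omega$ is a minimizer $\bar\nu\in\mathcal P(X)$ of $\nu\mapsto\int W_2^2(\mu,\nu)\,d\Omega(\mu)$. $\mathrm{Ent}_{\mathfrak m}(\mu)=\int\rho\ln\rho\,d\mathfrak m$ if $\mu=\rho\,\mathfrak m$, and $+\infty$ if $\mu\not\ll\mathfrak m$ (an integral whose positive part is infinite is $+\infty$). The space satisfies $\mathrm{BCD}(K,\infty)$, $K\in\mathbb R$, if every probability measure $\Omega$ on $\mathcal P(X)$ with $\mathrm{Var}(\Omega)<\infty$ that is concentrated on finitely many measures has a Wasserstein barycenter $\bar\mu$ with $$\mathrm{Ent}_{\mathfrak m}(\bar\mu)\le\int_{\mathcal P(X)}\mathrm{Ent}_{\mathfrak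 m}(\mu)\,d\Omega(\mu)-\frac K2\mathrm{Var}(\Omega).$$ It satisfies the *exponential volume growth condition* if for every $x_0\in X$ there is $c>0$ with $\int_X e^{-c\,\mathsf d(x_0,x)^2}\,d\mathfrak m(x)<\infty$, where $e^{-\infty}=0$ (if $\mathsf d$ is finite, it is equivalent to ask this for one $x_0$). **Theorem.** Let $(X,\mathsf d,\mathfrak m)$ be an extended metric measure space satisfying $\mathrm{BCD}(K,\infty)$ for some $K\in\mathbb R$, and let $\Omega$ be a Radon probability measure on $(\mathcal P(X),\mathcal B(\bar\tau))$ with $$\mathrm{Var}(\Omega)<\infty\qquad\text{and}\qquad\int_{\mathcal P(X)}\mathrm{Ent}_{\mathfrak m}(\mu)\,d\Omega(\mu)<\infty .$$ Then $\Omega$ has a Wasserstein barycenter if one of the following holds: - **(A)** $(X,\mathsf d,\mathfrak m)$ satisfies the exponential volume growth condition and $\Omega$ is concentrated on $\mathcal P_2(X,\mathsf d)$; - **(B)** $\mathfrak m$ is a probability measure. -/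

import Mathlib

open MeasureTheory Filter Topology
open scoped ENNReal NNReal BoundedContinuousFunction

noncomputable section

/-! ### Extended metric-topological spaces -/

/-- An extended distance: symmetric, triangle inequality, zero exactly on the diagonal,
with values in `[0, ∞]`. -/
structure IsExtendedMetric {X : Type*} (d : X → X → ℝ≥0∞) : Prop where
  symm : ∀ x y, d x y = d y x
  triangle : ∀ x y z, d x z ≤ d x y + d y z
  eq_zero_iff : ∀ x y, d x y = 0 ↔ x = y

/-- `Lip_b(X, τ, d)`: the bounded, `τ`-continuous, `d`-Lipschitz real functions. -/
def lipB {X : Type*} [TopologicalSpace X] (d : X → X → ℝ≥0∞) : Set (X → ℝ) :=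
  {f | Continuous f ∧ (∃ C : ℝ, ∀ x, |f x| ≤ C) ∧
    ∃ L : ℝ≥0, ∀ x y, ENNReal.ofReal |f x - f y| ≤ L * d x y}

/-- The functions of `Lip_b(X, τ, d)` with Lipschitz constant at most one. -/
def lipBOne {X : Type*} [TopologicalSpace X] (d : X → X → ℝ≥0∞) : Set (X → ℝ) :=
  {f | f ∈ lipB d ∧ ∀ x y, ENNReal.ofReal |f x - f y| ≤ d x y}

/-- `(X, τ, d)` is an extended metric-topological space: `τ` is a Hausdorff topology, `d` is an
extended distance, `τ` is generated by `Lip_b(X, τ, d)`, and `d` is recovered from the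
1-Lipschitz functions of that class. -/
structure IsExtendedMetricTopological {X : Type*} [t : TopologicalSpace X]
    (d : X → X → ℝ≥0∞) : Prop where
  isExtendedMetric : IsExtendedMetric d
  t2 : T2Space X
  topology_eq : t = ⨅ f ∈ lipB d, TopologicalSpace.induced f inferInstance
  dist_eq : ∀ x y, d x y = ⨆ f ∈ lipBOne d, ENNReal.ofReal |f x - f y|

/-- Completeness of an extended metric (all its finite-distance components are complete):
every `d`-Cauchy sequence converges with respect to `d`. -/
def IsCompleteDist {X : Type*} (d : X → X → ℝ≥0∞) : Prop :=
  ∀ u : ℕ → X, (∀ ε : ℝ≥0∞, 0 < ε → ∃ N, ∀ k ≥ N, ∀ l ≥ N, d (u k) (u l) < ε) →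
    ∃ x, Tendsto (fun n => d (u n) x) atTop (𝓝 0)

/-! ### Radon measures

All measures on `X` and on `X × X` live on the Borel σ-algebra of the (product) topology.
For `X × X` this may be larger than the product σ-algebra, hence the explicit `borel`. -/

/-- Extended metric measure space: a complete extended metric-topological space with a
non-negative Radon measure (locally finite, inner regular with respect to compact sets) of
full support. -/
structure IsExtendedMetricMeasureSpace {X : Type*} [TopologicalSpace X]
    (d : X → X → ℝ≥0∞) (m : @Measure X (borel X)) : Prop where
  isExtendedMetricTopological : IsExtendedMetricTopological d
  complete : IsCompleteDist d
  locallyFinite : @IsLocallyFiniteMeasure X (borel X) _ m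
  innerRegular : @Measure.InnerRegular X (borel X) _ m
  fullSupport : @Measure.IsOpenPosMeasure X _ (borel X) m

/-- `𝒫(Y)`: the Radon probability measures on the Borel sets of `Y`. -/
structure RadonProb (Y : Type*) [TopologicalSpace Y] where
  toMeasure : @Measure Y (borel Y)
  isProbabilityMeasure : @IsProbabilityMeasure Y (borel Y) toMeasure
  innerRegular : @Measure.InnerRegular Y (borel Y) _ toMeasure

/-- The narrow topology on `𝒫(X)`: the coarsest one for which `μ ↦ ∫ f dμ` is continuous for
every bounded continuous `f`. It is not made an instance. -/
abbrev narrowTopology (X : Type*) [TopologicalSpace X] : TopologicalSpace (RadonProb X) :=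
  ⨅ f : X →ᵇ ℝ, TopologicalSpace.induced
    (fun μ : RadonProb X => ∫ x, f x ∂μ.toMeasure) inferInstance

/-! ### Wasserstein distance, variance, barycenters -/

/-- Transport plans between `μ` and `ν`: Radon probability measures on `X × X` with marginals
`μ` and `ν`. -/
def couplings {X : Type*} [TopologicalSpace X] (μ ν : RadonProb X) : Set (RadonProb (X × X)) :=
  {π | @Measure.map (X × X) X (borel (X × X)) (borel X) Prod.fst π.toMeasure = μ.toMeasure ∧
    @Measure.map (X × X) X (borel (X × X)) (borel X) Prod.snd π.toMeasure = ν.toMeasure}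

/-- `W₂²(μ, ν)`. -/
def wassersteinSq {X : Type*} [TopologicalSpace X] (d : X → X → ℝ≥0∞) (μ ν : RadonProb X) :
    ℝ≥0∞ :=
  ⨅ π ∈ couplings μ ν, ∫⁻ p, d p.1 p.2 ^ 2 ∂π.toMeasure

/-- `W₂(μ, ν)`. -/
def wasserstein {X : Type*} [TopologicalSpace X] (d : X → X → ℝ≥0∞) (μ ν : RadonProb X) :
    ℝ≥0∞ :=
  wassersteinSq d μ ν ^ (1 / 2 : ℝ)

/-- `𝒫₂(X, d)`: finite second moment about some point. -/
def radonProbTwo {X : Type*} [TopologicalSpace X] (d : X → X → ℝ≥0∞) : Set (RadonProb X) :=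
  {μ | ∃ x₀ : X, ∫⁻ y, d x₀ y ^ 2 ∂μ.toMeasure < ∞}

/-- `Var(Ω) = inf_ν ∫ W₂²(μ, ν) dΩ(μ)`. -/
def wassersteinVar {X : Type*} [TopologicalSpace X] {_ : MeasurableSpace (RadonProb X)}
    (d : X → X → ℝ≥0∞) (Ω : Measure (RadonProb X)) : ℝ≥0∞ :=
  ⨅ ν : RadonProb X, ∫⁻ μ, wassersteinSq d μ ν ∂Ω

/-- `ν` is a Wasserstein barycenter of `Ω`: it minimises `∫ W₂²(μ, ·) dΩ(μ)` over `𝒫(X)`. -/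
def IsWassersteinBarycenter {X : Type*} [TopologicalSpace X] {_ : MeasurableSpace (RadonProb X)}
    (d : X → X → ℝ≥0∞) (Ω : Measure (RadonProb X)) (ν : RadonProb X) : Prop :=
  ∀ ν' : RadonProb X, ∫⁻ μ, wassersteinSq d μ ν ∂Ω ≤ ∫⁻ μ, wassersteinSq d μ ν' ∂Ω

/-! ### Entropy, curvature-dimension condition, volume growth -/

open Classical in
/-- Integral of an extended real function: positive part minus negative part, with the
convention that it is `+∞` as soon as the positive part has infinite integral. -/
def extIntegral {α : Type*} {_ : MeasurableSpace α} (ν : Measure α) (g : α → EReal) : EReal :=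
  if ∫⁻ a, (g a).toENNReal ∂ν = ∞ then ⊤
  else ((∫⁻ a, (g a).toENNReal ∂ν : ℝ≥0∞) : EReal) - ((∫⁻ a, (-(g a)).toENNReal ∂ν : ℝ≥0∞) : EReal)

open Classical in
/-- Relative entropy `Ent_m(μ) = ∫ ρ log ρ dm` if `μ = ρ m`, and `+∞` if `μ` is not absolutely
continuous with respect to `m`. -/
def relEntropy {X : Type*} [TopologicalSpace X] (m : @Measure X (borel X)) (μ : RadonProb X) :
    EReal :=
  if μ.toMeasure ≪ m then
    extIntegral m (fun x =>
      (((μ.toMeasure.rnDeriv m x).toReal * Real.log (μ.toMeasure.rnDeriv m x).toReal : ℝ) : EReal))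
  else ⊤

/-- `BCD(K, ∞)`: every probability measure `Ω` on `𝒫(X)` with finite variance and concentrated
on finitely many measures has a barycenter `ν` with
`Ent_m(ν) ≤ ∫ Ent_m dΩ - (K / 2) Var(Ω)`. -/
def BCD {X : Type*} [TopologicalSpace X] [MeasurableSpace (RadonProb X)]
    (d : X → X → ℝ≥0∞) (m : @Measure X (borel X)) (K : ℝ) : Prop :=
  ∀ Ω : Measure (RadonProb X), IsProbabilityMeasure Ω →
    (∃ S : Set (RadonProb X), S.Finite ∧ Ω Sᶜ = 0) → wassersteinVar d Ω < ∞ →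
    ∃ ν : RadonProb X, IsWassersteinBarycenter d Ω ν ∧
      relEntropy m ν ≤
        extIntegral Ω (relEntropy m) - ((K / 2 * (wassersteinVar d Ω).toReal : ℝ) : EReal)

open Classical in
/-- Exponential volume growth: for every `x₀` there is `c > 0` with
`∫ exp (-c d(x₀, x)²) dm(x) < ∞`, where `exp (-∞) = 0`. (For a finite distance one base point
suffices; in general every finite-distance component needs its own.) -/
def ExpVolumeGrowth {X : Type*} [TopologicalSpace X] (d : X → X → ℝ≥0∞)
    (m : @Measure X (borel X)) : Prop :=
  ∀ x₀ : X, ∃ c : ℝ, 0 < c ∧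
    ∫⁻ x, (if d x₀ x = ∞ then 0 else ENNReal.ofReal (Real.exp (-c * (d x₀ x).toReal ^ 2))) ∂m < ∞

end

/-! ### Completely regular spaces and tight functionals -/

/-! The direct method is applied to barycenters of finitely supported approximations of `Ω`.
Integrals of finitely many functions against `Ω` are the coordinates of a mean vector, which lies in
the closed convex hull of the values of these functions. So finitely supported measures `Ω'` exist
whose integrals exceed those of `Ω` by at most a prescribed error. Directing the choice by growing
finite sets of test functions and shrinking errors gives asymptotic upper bounds for every
measurable integrable function, continuous or not.

The condition `BCD` supplies barycenters `ν i` of the approximations with uniformly bounded entropy.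
In case (A) the triangle inequality and the optimality of `ν i` also bound their second moments
about a fixed point, and volume growth makes the exponential weight integrable; in case (B) the zero
potential suffices. The weight controls the negative part of the entropy, hence also the positive
part, so the densities are uniformly integrable and the `ν i` are uniformly tight
(`exists_isCompact_of_relEntropy_le`). They converge narrowly along an ultrafilter to some `ν'`.

It remains to pass to the limit in the cost, by `lintegral_wassersteinSq_le_of_tendsto`. Kantorovich
duality writes the cost as a supremum of dual values; a finite maximum of these is bounded and
continuous in `μ` and varies with `ν` uniformly in `μ`. The Radon property of `Ω` then allows the
directed supremum. A competitor with finite cost is itself an admissible test function, so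
minimality survives in the limit.

Duality on a completely regular space comes from the Riesz extension theorem: the functional
obtained inherits tightness from the marginals, and Riesz–Markov on the Stone–Čech compactification
represents it by a Radon plan. -/

theorem exists_bounded_separation {Y : Type*} [TopologicalSpace Y] [T35Space Y] {K U : Set Y}
    (hK : IsCompact K) (hU : IsOpen U) (hKU : K ⊆ U) :
    ∃ f : Y →ᵇ ℝ, (∀ y, 0 ≤ f y) ∧ (∀ y, f y ≤ 1) ∧ (∀ y ∈ K, f y = 0) ∧ ∀ y ∉ U, f y = 1 := by
  -- The Stone–Čech compactification is normal and the image of `K` in it is closed, so Urysohn's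
  -- lemma applies there.
  have hemb := isEmbedding_stoneCechUnit (X := Y)
  obtain ⟨V, hV, rfl⟩ := hemb.isInducing.isOpen_iff.1 hU
  have hdis : Disjoint (stoneCechUnit '' K) Vᶜ := by
    rw [Set.disjoint_compl_right_iff_subset]
    rintro _ ⟨y, hy, rfl⟩
    exact hKU hy
  obtain ⟨f, hf0, hf1, hf⟩ := exists_continuous_zero_one_of_isClosed
    (hK.image continuous_stoneCechUnit).isClosed hV.isClosed_compl hdis
  refine ⟨(BoundedContinuousFunction.mkOfCompact f).compContinuous
    ⟨stoneCechUnit, continuous_stoneCechUnit⟩, fun y => (hf _).1, fun y => (hf _).2,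
    fun y hy => hf0 ⟨y, hy, rfl⟩, fun y hy => hf1 hy⟩

theorem exists_stoneCech_extension {Y : Type*} [TopologicalSpace Y] (g : Y →ᵇ ℝ) :
    ∃ h : StoneCech Y → ℝ, Continuous h ∧ ∀ y, h (stoneCechUnit y) = g y := by
  have hb : ∀ y, g y ∈ Set.Icc (-‖g‖) ‖g‖ := fun y => abs_le.1 (g.norm_coe_le_norm y)
  have hc : Continuous (fun y => (⟨g y, hb y⟩ : Set.Icc (-‖g‖) ‖g‖)) :=
    g.continuous.subtype_mk _
  exact ⟨fun z => ((stoneCechExtend hc z : Set.Icc (-‖g‖) ‖g‖) : ℝ), continuous_subtype_val.comp (continuous_stoneCechExtend hc),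
    fun y => congrArg Subtype.val (stoneCechExtend_stoneCechUnit hc y)⟩

/-- A tight positive normalised functional on the bounded continuous functions of a
completely regular Hausdorff space is integration against a Radon probability measure. -/
theorem exists_measure_of_tight_functional {Y : Type*} [TopologicalSpace Y] [T35Space Y]
    [MeasurableSpace Y] [BorelSpace Y] (Λ : (Y →ᵇ ℝ) →ₗ[ℝ] ℝ)
    (hpos : ∀ g : Y →ᵇ ℝ, (∀ y, 0 ≤ g y) → 0 ≤ Λ g)
    (hone : Λ (BoundedContinuousFunction.const Y 1) = 1)
    (htight : ∀ ε : ℝ, 0 < ε → ∃ K : Set Y, IsCompact K ∧ ∀ g : Y →ᵇ ℝ, (∀ y, 0 ≤ g y) →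
      (∀ y, g y ≤ 1) → (∀ y ∈ K, g y = 0) → Λ g ≤ ε) :
    ∃ π : Measure Y, IsProbabilityMeasure π ∧ π.InnerRegular ∧ ∀ g, Λ g = ∫ y, g y ∂π := by
  borelize (StoneCech Y)
  let ι : C(Y, StoneCech Y) := ⟨stoneCechUnit, continuous_stoneCechUnit⟩
  let T : CompactlySupportedContinuousMap (StoneCech Y) ℝ →ₗ[ℝ] ℝ :=
    { toFun := fun h => Λ ((BoundedContinuousFunction.mkOfCompact h.toContinuousMap).compContinuous ι)
      map_add' := fun h h' => by
        rw [← map_add]; rfl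
      map_smul' := fun c h => by
        rw [RingHom.id_apply, ← map_smul]; rfl }
  let Λ' : CompactlySupportedContinuousMap (StoneCech Y) ℝ →ₚ[ℝ] ℝ := PositiveLinearMap.mk₀ T
    (fun h hh => hpos _ fun y => hh (stoneCechUnit y))
  let P := RealRMK.rieszMeasure Λ'
  have hPint : ∀ (h : StoneCech Y → ℝ) (hc : Continuous h) (g : Y →ᵇ ℝ),
      (∀ y, h (stoneCechUnit y) = g y) → ∫ z, h z ∂P = Λ g := by
    intro h hc g hg
    let h' : CompactlySupportedContinuousMap (StoneCech Y) ℝ :=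
      ⟨⟨h, hc⟩, HasCompactSupport.of_compactSpace _⟩
    have := RealRMK.integral_rieszMeasure Λ' h'
    refine this.trans (congrArg Λ ?_)
    ext y
    exact hg y
  have hreg : P.Regular := inferInstance
  have hfin : IsFiniteMeasure P := inferInstance
  have hPuniv : P Set.univ = 1 := by
    have := hPint (fun _ => 1) continuous_const (BoundedContinuousFunction.const Y 1)
      (fun _ => rfl)
    rw [hone, integral_const, smul_eq_mul, mul_one] at this
    rw [← ENNReal.toReal_eq_one_iff]
    exact this
  -- Tightness passes to `P`: a compact `L` missing the image of `K` is tested by a Urysohn function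
  -- vanishing on that image and equal to one on `L`.
  have hK : ∀ n : ℕ, ∃ K : Set Y, IsCompact K ∧ P (stoneCechUnit '' K)ᶜ ≤
      ENNReal.ofReal (1 / (n + 1)) := by
    intro n
    obtain ⟨K, hK, hg⟩ := htight (1 / (n + 1)) (by positivity)
    refine ⟨K, hK, ?_⟩
    have hcl := (hK.image (continuous_stoneCechUnit (α := Y))).isClosed
    refine le_of_forall_lt fun r hr => ?_
    obtain ⟨L, hLU, hL, hrL⟩ := hcl.isOpen_compl.exists_lt_isCompact hr
    refine hrL.trans_le ?_
    obtain ⟨f, hf0, hf1, hf⟩ := exists_continuous_zero_one_of_isClosed hcl hL.isClosed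
      (Set.disjoint_left.2 fun z hz hz' => hLU hz' hz)
    have h1 := hPint f f.continuous ((BoundedContinuousFunction.mkOfCompact f).compContinuous ι)
      (fun _ => rfl)
    have h2 := hg ((BoundedContinuousFunction.mkOfCompact f).compContinuous ι)
      (fun y => (hf _).1) (fun y => (hf _).2) (fun y hy => hf0 ⟨y, hy, rfl⟩)
    rw [← h1] at h2
    have hint : Integrable f P := f.continuous.integrable_of_hasCompactSupport
      (HasCompactSupport.of_compactSpace _)
    calc P L = ∫⁻ z in L, 1 ∂P := by simp
      _ ≤ ∫⁻ z in L, ENNReal.ofReal (f z) ∂P := by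
          refine setLIntegral_mono (by fun_prop) fun z hz => ?_
          rw [hf1 hz]; simp
      _ ≤ ∫⁻ z, ENNReal.ofReal (f z) ∂P := setLIntegral_le_lintegral _ _
      _ = ENNReal.ofReal (∫ z, f z ∂P) :=
          (ofReal_integral_eq_lintegral_ofReal hint (ae_of_all _ fun z => (hf z).1)).symm
      _ ≤ _ := ENNReal.ofReal_le_ofReal h2
  choose K hKc hKP using hK
  -- The image of `Y` in its compactification need not be measurable. The image of the σ-compact `S`
  -- is, and it carries all of `P`, so `P` is pulled back to `S` and pushed into `Y`.
  let S : Set Y := ⋃ n, K n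
  let j : S → StoneCech Y := fun y => stoneCechUnit (y : Y)
  have hrange : Set.range j = ⋃ n, stoneCechUnit '' K n := by
    rw [← Set.image_iUnion]
    ext z
    simp [j, S]
  have hjm : MeasurableSet (Set.range j) := by
    rw [hrange]
    exact MeasurableSet.iUnion fun n => ((hKc n).image continuous_stoneCechUnit).measurableSet
  have hjemb : IsEmbedding j := isEmbedding_stoneCechUnit.comp IsEmbedding.subtypeVal
  have hj : MeasurableEmbedding j := hjemb.measurableEmbedding hjm
  have hnull : P (Set.range j)ᶜ = 0 := by
    refine le_antisymm (ge_of_tendsto' (x := atTop)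
      (f := fun n : ℕ => ENNReal.ofReal (1 / ((n : ℝ) + 1))) ?_ fun n => ?_) bot_le
    · simpa using ENNReal.tendsto_ofReal tendsto_one_div_add_atTop_nhds_zero_nat
    · refine le_trans (measure_mono ?_) (hKP n)
      rw [hrange]
      exact Set.compl_subset_compl.2 (Set.subset_iUnion (fun n => stoneCechUnit '' K n) n)
  have hrestr : P.restrict (Set.range j) = P := Measure.restrict_eq_self_of_ae_mem hnull
  have hPinner : P.InnerRegular := inferInstance
  have hcomapreg : (P.comap j).InnerRegular :=
    ⟨hPinner.innerRegular.comap hj (fun _ hU => hj.measurableSet_image' hU)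
      (fun _ hKr hK => hjemb.isInducing.isCompact_preimage' hK hKr)⟩
  refine ⟨(P.comap j).map Subtype.val, ⟨?_⟩,
    Measure.InnerRegular.map_of_continuous continuous_subtype_val, fun g => ?_⟩
  · rw [Measure.map_apply measurable_subtype_coe MeasurableSet.univ, Set.preimage_univ,
      hj.comap_apply, Set.image_univ, ← hPuniv]
    conv_rhs => rw [← hrestr]
    simp
  · obtain ⟨h, hc, hg⟩ := exists_stoneCech_extension g
    rw [← hPint h hc g hg, integral_map measurable_subtype_coe.aemeasurable
      g.continuous.aestronglyMeasurable]
    have : ∀ y : S, g (y : Y) = h (j y) := fun y => (hg y).symm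
    simp_rw [this]
    rw [← hj.integral_map, hj.map_comap, hrestr]

/-- Finite Radon measures with the same integrals of bounded continuous functions agree. -/
theorem measure_eq_of_forall_integral_eq {Y : Type*} [TopologicalSpace Y] [T35Space Y]
    [MeasurableSpace Y] [BorelSpace Y] {μ ν : Measure Y} [IsFiniteMeasure μ] [IsFiniteMeasure ν]
    (hμ : μ.InnerRegular) (hν : ν.InnerRegular)
    (h : ∀ g : Y →ᵇ ℝ, ∫ y, g y ∂μ = ∫ y, g y ∂ν) : μ = ν := by
  -- A continuous function squeezed between the indicators of `K` and of an open `U ⊇ K` with `μ U`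
  -- close to `μ K` compares the two measures on compact sets.
  have key : ∀ (μ ν : Measure Y) [IsFiniteMeasure μ] [IsFiniteMeasure ν],
      μ.InnerRegular → (∀ g : Y →ᵇ ℝ, ∫ y, g y ∂μ = ∫ y, g y ∂ν) →
      ∀ K, IsCompact K → ν K ≤ μ K := by
    intro μ ν _ _ hμ h K hK
    refine le_of_forall_gt fun r hr => ?_
    obtain ⟨U, hKU, hU, hUr⟩ := hK.exists_isOpen_lt_of_lt (μ := μ) r hr
    refine lt_of_le_of_lt ?_ hUr
    obtain ⟨f, hf0, hf1, hfK, hfU⟩ := exists_bounded_separation hK hU hKU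
    have hle : ∀ (ρ : Measure Y) [IsFiniteMeasure ρ], ∫⁻ y, ENNReal.ofReal (1 - f y) ∂ρ
        = ENNReal.ofReal (∫ y, ((BoundedContinuousFunction.const Y (1 : ℝ) - f : Y →ᵇ ℝ)) y ∂ρ) := fun ρ _ => by
      rw [ofReal_integral_eq_lintegral_ofReal (BoundedContinuousFunction.integrable _ _)
        (ae_of_all _ fun y => by simp [hf1 y])]
      rfl
    calc ν K = ∫⁻ y in K, 1 ∂ν := by simp
      _ ≤ ∫⁻ y in K, ENNReal.ofReal (1 - f y) ∂ν := by
          refine setLIntegral_mono (by fun_prop) fun y hy => ?_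
          simp [hfK y hy]
      _ ≤ ∫⁻ y, ENNReal.ofReal (1 - f y) ∂ν := setLIntegral_le_lintegral _ _
      _ = ∫⁻ y, ENNReal.ofReal (1 - f y) ∂μ := by rw [hle, hle, h]
      _ ≤ ∫⁻ y, U.indicator 1 y ∂μ := by
          refine lintegral_mono fun y => ?_
          by_cases hy : y ∈ U
          · simp [hy, hf0 y]
          · simp [hy, hfU y hy]
      _ = μ U := lintegral_indicator_one hU.measurableSet
  ext s hs
  rw [hs.measure_eq_iSup_isCompact μ, hs.measure_eq_iSup_isCompact ν]
  refine iSup_congr fun K => iSup_congr fun _ => iSup_congr fun hK => ?_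
  exact le_antisymm (key ν μ hν (fun g => (h g).symm) K hK) (key μ ν hμ h K hK)

/-- Monotone convergence for upward directed families of lower semicontinuous functions and
finite Radon measures. -/
theorem lintegral_iSup_le_of_directed {Y ι : Type*} [TopologicalSpace Y] [T2Space Y]
    [MeasurableSpace Y] [BorelSpace Y] [Nonempty ι] (μ : Measure Y) [IsFiniteMeasure μ]
    [μ.InnerRegular] (g : ι → Y → ℝ≥0∞) (hg : ∀ i, LowerSemicontinuous (g i))
    (hdir : Directed (· ≤ ·) g) {C : ℝ≥0∞} (hC : ∀ i, ∫⁻ y, g i y ∂μ ≤ C) :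
    ∫⁻ y, ⨆ i, g i y ∂μ ≤ C := by
  have hopen : ∀ (i) (t : ℝ≥0∞), IsOpen {y | t < g i y} := fun i t => (hg i).isOpen_preimage t
  -- At a fixed level, a compact set filling most of the open superlevel set of the supremum lies in
  -- the superlevel set of a single member, by directedness. Countably many members thus suffice up
  -- to a null set.
  have hchoose : ∀ t : ℝ≥0∞, ∃ c : ℕ → ι, μ ({y | t < ⨆ i, g i y} \ ⋃ n, {y | t < g (c n) y}) = 0 := by
    intro t
    have hU : IsOpen {y | t < ⨆ i, g i y} := by
      have : {y | t < ⨆ i, g i y} = ⋃ i, {y | t < g i y} := by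
        ext y; simp [lt_iSup_iff]
      rw [this]
      exact isOpen_iUnion fun i => hopen i t
    have hKn : ∀ n : ℕ, ∃ i, μ ({y | t < ⨆ i, g i y} \ {y | t < g i y}) ≤
        ENNReal.ofReal (1 / (n + 1)) := by
      intro n
      obtain ⟨K, hKU, hK, hKlt⟩ := hU.measurableSet.exists_isCompact_sdiff_lt (μ := μ)
        (measure_ne_top _ _) (ε := ENNReal.ofReal (1 / (n + 1))) (by simp; positivity)
      obtain ⟨i, hi⟩ := hK.elim_directed_cover (fun i => {y | t < g i y}) (fun i => hopen i t)
        (fun y hy => by simpa [lt_iSup_iff] using hKU hy)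
        (fun i j => by
          obtain ⟨k, hik, hjk⟩ := hdir i j
          exact ⟨k, fun y hy => lt_of_lt_of_le hy (hik y), fun y hy => lt_of_lt_of_le hy (hjk y)⟩)
      exact ⟨i, (measure_mono (Set.sdiff_subset_sdiff_right hi)).trans hKlt.le⟩
    choose c hc using hKn
    refine ⟨c, le_antisymm (ge_of_tendsto' (x := atTop)
      (f := fun n : ℕ => ENNReal.ofReal (1 / ((n : ℝ) + 1))) ?_ fun n => ?_) bot_le⟩
    · simpa using ENNReal.tendsto_ofReal tendsto_one_div_add_atTop_nhds_zero_nat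
    · exact (measure_mono (Set.sdiff_subset_sdiff_right
        (Set.subset_iUnion (fun n => {y | t < g (c n) y}) n))).trans (hc n)
  choose c hc using hchoose
  -- Rational levels determine the supremum, so one sequence enumerates all members needed; codes
  -- that decode to nothing harmlessly give `c 0 0`.
  let e : ℕ → ι := fun n => c ((Encodable.decode (α := ℚ × ℕ) n).elim 0
    fun q => ENNReal.ofReal q.1) ((Encodable.decode (α := ℚ × ℕ) n).elim 0 fun q => q.2)
  have he : ∀ (q : ℚ) (k : ℕ), ∃ n, e n = c (ENNReal.ofReal q) k := fun q k =>
    ⟨Encodable.encode (q, k), by simp [e]⟩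
  obtain ⟨z, hz⟩ : ∃ z : ℕ → ι, Monotone (fun n => g (z n)) ∧ ∀ n, g (e n) ≤ g (z n) := by
    choose u hu1 hu2 using hdir
    let z : ℕ → ι := fun n => Nat.rec (e 0) (fun n i => u i (e (n + 1))) n
    refine ⟨z, monotone_nat_of_le_succ fun n => hu1 _ _, fun n => ?_⟩
    cases n with
    | zero => exact le_rfl
    | succ n => exact hu2 _ _
  have hae : ∀ᵐ y ∂μ, ⨆ i, g i y ≤ ⨆ n, g (z n) y := by
    have : ∀ᵐ y ∂μ, ∀ q : ℚ, y ∉ {y | ENNReal.ofReal q < ⨆ i, g i y} \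
        ⋃ n, {y | ENNReal.ofReal q < g (c (ENNReal.ofReal q) n) y} :=
      ae_all_iff.2 fun q => measure_eq_zero_iff_ae_notMem.1 (hc _)
    filter_upwards [this] with y hy
    refine le_of_forall_lt fun r hr => ?_
    obtain ⟨q, hq0, hrq, hq⟩ := ENNReal.lt_iff_exists_rat_btwn.1 hr
    have h1 := hy q
    simp only [Set.mem_sdiff, Set.mem_ofPred_eq, Set.mem_iUnion, not_and, not_not] at h1
    obtain ⟨k, hk⟩ := h1 hq
    obtain ⟨n, hn⟩ := he q k
    rw [← hn] at hk
    exact hrq.trans (lt_of_lt_of_le hk ((hz.2 n y).trans (le_iSup (fun n => g (z n) y) n)))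
  calc ∫⁻ y, ⨆ i, g i y ∂μ ≤ ∫⁻ y, ⨆ n, g (z n) y ∂μ := lintegral_mono_ae hae
    _ = ⨆ n, ∫⁻ y, g (z n) y ∂μ :=
        lintegral_iSup (fun n => (hg _).measurable) hz.1
    _ ≤ C := iSup_le fun n => hC _

/-! ### Kantorovich duality -/

/-- A topology induced by real functions is completely regular. -/
theorem IsExtendedMetricTopological.t35Space {X : Type*} [t : TopologicalSpace X]
    {d : X → X → ℝ≥0∞} (hd : IsExtendedMetricTopological d) : T35Space X := by
  have h1 : CompletelyRegularSpace X := by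
    rw [hd.topology_eq, iInf_subtype']
    exact completelyRegularSpace_iInf fun f => completelyRegularSpace_induced inferInstance f.1
  have h2 := hd.t2
  exact {}

/-- Nonnegative bounded continuous functions below the squared distance. -/
def costMinorants {X : Type*} [TopologicalSpace X] (d : X → X → ℝ≥0∞) : Set ((X × X) →ᵇ ℝ) :=
  {h | ∀ x y, ENNReal.ofReal (h (x, y)) ≤ d x y ^ 2}

theorem iSup_costMinorants {X : Type*} [TopologicalSpace X] {d : X → X → ℝ≥0∞}
    (hd : IsExtendedMetricTopological d) (p : X × X) :
    ⨆ h : costMinorants d, ENNReal.ofReal (h.1 p) = d p.1 p.2 ^ 2 := by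
  refine le_antisymm (iSup_le fun h => h.2 p.1 p.2) ?_
  rw [hd.dist_eq]
  simp only [ENNReal.iSup_pow_of_ne_zero two_ne_zero]
  refine iSup₂_le fun f hf => ?_
  obtain ⟨⟨hfc, ⟨C, hC⟩, -⟩, hf1⟩ := hf
  -- The distance is a supremum over bounded 1-Lipschitz `f`, so the squares of the increments of
  -- `f` already exhaust its square.
  let h : (X × X) →ᵇ ℝ := BoundedContinuousFunction.ofNormedAddCommGroup
    (fun q : X × X => |f q.1 - f q.2| ^ 2) (by fun_prop) ((2 * C) ^ 2) (fun q => by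
      rw [norm_pow, Real.norm_eq_abs, abs_abs]
      gcongr
      calc |f q.1 - f q.2| ≤ |f q.1| + |f q.2| := abs_sub _ _
        _ ≤ 2 * C := by linarith [hC q.1, hC q.2])
  have hh : h ∈ costMinorants d := fun x y => by
    change ENNReal.ofReal (|f x - f y| ^ 2) ≤ _
    rw [ENNReal.ofReal_pow (abs_nonneg _)]
    gcongr
    exact hf1 x y
  refine le_trans ?_ (le_iSup (fun h : costMinorants d => ENNReal.ofReal (h.1 p)) ⟨h, hh⟩)
  rw [← ENNReal.ofReal_pow (abs_nonneg _)]
  rfl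

theorem directed_costMinorants {X : Type*} [TopologicalSpace X] (d : X → X → ℝ≥0∞) :
    Directed (· ≤ ·) (fun (h : costMinorants d) (p : X × X) => ENNReal.ofReal (h.1 p)) := by
  intro h h'
  refine ⟨⟨h.1 ⊔ h'.1, fun x y => ?_⟩, fun p => ?_, fun p => ?_⟩
  · rw [BoundedContinuousFunction.coe_sup, Pi.sup_apply]
    rcases le_total (h.1 (x, y)) (h'.1 (x, y)) with hle | hle
    · rw [sup_eq_right.2 hle]; exact h'.2 x y
    · rw [sup_eq_left.2 hle]; exact h.2 x y
  · exact ENNReal.ofReal_le_ofReal (by simp)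
  · exact ENNReal.ofReal_le_ofReal (by simp)

theorem lowerSemicontinuous_dist_sq {X : Type*} [TopologicalSpace X] {d : X → X → ℝ≥0∞}
    (hd : IsExtendedMetricTopological d) :
    LowerSemicontinuous (fun p : X × X => d p.1 p.2 ^ 2) := by
  simp_rw [← iSup_costMinorants hd]
  exact lowerSemicontinuous_iSup fun h => (ENNReal.continuous_ofReal.comp h.1.continuous).lowerSemicontinuous

/-- Pairs of dual potentials. -/
def dualPairs {X : Type*} [TopologicalSpace X] (d : X → X → ℝ≥0∞) :
    Set ((X →ᵇ ℝ) × (X →ᵇ ℝ)) :=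
  {q | ∀ x y, ENNReal.ofReal (q.1 x + q.2 y) ≤ d x y ^ 2}

/-- The value of a pair of dual potentials. -/
noncomputable def dualValue {X : Type*} [TopologicalSpace X] (μ ν : RadonProb X)
    (q : (X →ᵇ ℝ) × (X →ᵇ ℝ)) : ℝ :=
  ∫ x, q.1 x ∂μ.toMeasure + ∫ x, q.2 x ∂ν.toMeasure

theorem RadonProb.integrable {X : Type*} [TopologicalSpace X] (μ : RadonProb X) (f : X →ᵇ ℝ) :
    Integrable f μ.toMeasure := by
  let : MeasurableSpace X := borel X
  have : BorelSpace X := ⟨rfl⟩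
  have := μ.isProbabilityMeasure
  exact f.integrable _

theorem RadonProb.integral_const {X : Type*} [TopologicalSpace X] (μ : RadonProb X) (c : ℝ) :
    ∫ _, c ∂μ.toMeasure = c := by
  have := μ.isProbabilityMeasure
  simp

theorem measurable_fst_borel {X : Type*} [TopologicalSpace X] :
    @Measurable (X × X) X (borel (X × X)) (borel X) Prod.fst := by
  let : MeasurableSpace X := borel X
  let : MeasurableSpace (X × X) := borel (X × X)
  have : BorelSpace X := ⟨rfl⟩
  have : BorelSpace (X × X) := ⟨rfl⟩
  exact continuous_fst.measurable

theorem measurable_snd_borel {X : Type*} [TopologicalSpace X] :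
    @Measurable (X × X) X (borel (X × X)) (borel X) Prod.snd := by
  let : MeasurableSpace X := borel X
  let : MeasurableSpace (X × X) := borel (X × X)
  have : BorelSpace X := ⟨rfl⟩
  have : BorelSpace (X × X) := ⟨rfl⟩
  exact continuous_snd.measurable

theorem dualValue_le_wassersteinSq {X : Type*} [TopologicalSpace X] {d : X → X → ℝ≥0∞}
    (μ ν : RadonProb X) {q : (X →ᵇ ℝ) × (X →ᵇ ℝ)} (hq : q ∈ dualPairs d) :
    ENNReal.ofReal (dualValue μ ν q) ≤ wassersteinSq d μ ν := by
  let : MeasurableSpace X := borel X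
  let : MeasurableSpace (X × X) := borel (X × X)
  refine le_iInf₂ fun π hπ => ?_
  have h1 : ∫ x, q.1 x ∂μ.toMeasure = ∫ p, q.1 p.1 ∂π.toMeasure := by
    rw [← hπ.1, integral_map measurable_fst_borel.aemeasurable]
    rw [hπ.1]
    exact (μ.integrable q.1).aestronglyMeasurable
  have h2 : ∫ x, q.2 x ∂ν.toMeasure = ∫ p, q.2 p.2 ∂π.toMeasure := by
    rw [← hπ.2, integral_map measurable_snd_borel.aemeasurable]
    rw [hπ.2]
    exact (ν.integrable q.2).aestronglyMeasurable
  have i1 : Integrable (fun p : X × X => q.1 p.1) π.toMeasure :=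
    π.integrable (q.1.compContinuous ⟨Prod.fst, continuous_fst⟩)
  have i2 : Integrable (fun p : X × X => q.2 p.2) π.toMeasure :=
    π.integrable (q.2.compContinuous ⟨Prod.snd, continuous_snd⟩)
  rw [dualValue, h1, h2, ← integral_add i1 i2]
  refine (ENNReal.ofReal_le_ofReal (integral_mono (i1.add i2) (i1.add i2).pos_part
    fun p => le_max_left _ 0)).trans ?_
  rw [ofReal_integral_eq_lintegral_ofReal (i1.add i2).pos_part
    (ae_of_all _ fun p => le_max_right _ _)]
  refine lintegral_mono fun p => ?_
  refine le_trans (le_of_eq ?_) (hq p.1 p.2)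
  simp [ENNReal.ofReal_max]

/-- Two potentials, a multiple of the cost, and a function on the product. -/
abbrev DualSpace (X : Type*) [TopologicalSpace X] : Type _ :=
  (X →ᵇ ℝ) × (X →ᵇ ℝ) × ℝ × ((X × X) →ᵇ ℝ)

/-- Functionals dominated by the dual problem, obtained from the extension theorem of M. Riesz. -/
theorem exists_dual_functional {X : Type*} [TopologicalSpace X] {d : X → X → ℝ≥0∞}
    (μ ν : RadonProb X) {D : ℝ} (hD : ∀ q ∈ dualPairs d, dualValue μ ν q ≤ D) :
    ∃ Λ : ((X × X) →ᵇ ℝ) →ₗ[ℝ] ℝ, ∀ (h : (X × X) →ᵇ ℝ) (φ ψ : X →ᵇ ℝ) (t : ℝ), 0 ≤ t →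
      (∀ x y, ENNReal.ofReal (h (x, y) - φ x - ψ y) ≤ ENNReal.ofReal t * d x y ^ 2) →
      Λ h ≤ dualValue μ ν (φ, ψ) + t * D := by
  let Lf : DualSpace X →ₗ[ℝ] ℝ :=
    { toFun := fun e => dualValue μ ν (e.1, e.2.1) + e.2.2.1 * D
      map_add' := fun e e' => by
        simp only [dualValue, Prod.fst_add, Prod.snd_add, BoundedContinuousFunction.coe_add,
          Pi.add_apply]
        rw [integral_add (μ.integrable _) (μ.integrable _),
          integral_add (ν.integrable _) (ν.integrable _)]
        ring
      map_smul' := fun c e => by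
        simp only [dualValue, Prod.smul_fst, Prod.smul_snd, BoundedContinuousFunction.coe_smul,
          smul_eq_mul, integral_const_mul, RingHom.id_apply]
        ring }
  let dom : Submodule ℝ (DualSpace X) := LinearMap.ker ((LinearMap.snd ℝ ℝ ((X × X) →ᵇ ℝ)).comp
    ((LinearMap.snd ℝ (X →ᵇ ℝ) (ℝ × ((X × X) →ᵇ ℝ))).comp
      (LinearMap.snd ℝ (X →ᵇ ℝ) ((X →ᵇ ℝ) × ℝ × ((X × X) →ᵇ ℝ)))))
  have hdom : ∀ e : DualSpace X, e ∈ dom ↔ e.2.2.2 = 0 := fun e => by simp [dom]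
  -- A tuple `(φ, ψ, t, g)` stands for `φ(x) + ψ(y) + t d(x,y)² + g(x,y)`, and the cone asks that
  -- this be nonnegative. Since `0 * ∞ = 0`, for `t = 0` the condition also binds at pairs at
  -- infinite distance.
  let s : PointedCone ℝ (DualSpace X) :=
    { carrier := {e | 0 ≤ e.2.2.1 ∧ ∀ x y, ENNReal.ofReal (-(e.1 x + e.2.1 y + e.2.2.2 (x, y))) ≤
        ENNReal.ofReal e.2.2.1 * d x y ^ 2}
      zero_mem' := by simp
      add_mem' := by
        rintro e e' ⟨h0, h⟩ ⟨h0', h'⟩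
        refine ⟨add_nonneg h0 h0', fun x y => ?_⟩
        simp only [Prod.fst_add, Prod.snd_add, BoundedContinuousFunction.coe_add, Pi.add_apply]
        rw [ENNReal.ofReal_add h0 h0', add_mul]
        refine le_trans (le_trans (le_of_eq ?_) ENNReal.ofReal_add_le) (add_le_add (h x y) (h' x y))
        congr 1; ring
      smul_mem' := by
        rintro ⟨c, hc⟩ e ⟨h0, h⟩
        refine ⟨mul_nonneg hc h0, fun x y => ?_⟩
        change ENNReal.ofReal (-(c * e.1 x + c * e.2.1 y + c * e.2.2.2 (x, y))) ≤
          ENNReal.ofReal (c * e.2.2.1) * _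
        rw [ENNReal.ofReal_mul hc, mul_assoc]
        calc _ = ENNReal.ofReal (c * -(e.1 x + e.2.1 y + e.2.2.2 (x, y))) := by congr 1; ring
          _ = ENNReal.ofReal c * ENNReal.ofReal (-(e.1 x + e.2.1 y + e.2.2.2 (x, y))) :=
              ENNReal.ofReal_mul hc
          _ ≤ _ := by gcongr; exact h x y }
  have hs : ∀ e : DualSpace X, e ∈ s ↔ 0 ≤ e.2.2.1 ∧ ∀ x y,
      ENNReal.ofReal (-(e.1 x + e.2.1 y + e.2.2.2 (x, y))) ≤ ENNReal.ofReal e.2.2.1 * d x y ^ 2 :=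
    fun e => Iff.rfl
  obtain ⟨G, hG, hGs⟩ := riesz_extension s ⟨dom, Lf.domRestrict dom⟩ (by
    rintro ⟨⟨φ, ψ, t, g⟩, he⟩ hes
    obtain rfl : g = 0 := (hdom _).1 he
    obtain ⟨ht, h⟩ := (hs _).1 hes
    change 0 ≤ dualValue μ ν (φ, ψ) + t * D
    simp only [BoundedContinuousFunction.coe_zero, Pi.zero_apply, add_zero] at h ht
    rcases ht.eq_or_lt with rfl | ht
    -- Without the cost term, positivity follows by integrating in each variable in turn; for `t >
    -- 0`, dividing by `-t` turns the potentials into a dual pair.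
    · have hnn : ∀ x y, 0 ≤ φ x + ψ y := fun x y => by
        have := h x y
        simp only [ENNReal.ofReal_zero, zero_mul, nonpos_iff_eq_zero,
          ENNReal.ofReal_eq_zero] at this
        linarith
      have h1 : ∀ y, 0 ≤ ∫ x, φ x ∂μ.toMeasure + ψ y := fun y => by
        have : 0 ≤ ∫ x, (φ x + ψ y) ∂μ.toMeasure := integral_nonneg fun x => hnn x y
        have hpr := μ.isProbabilityMeasure
        rwa [integral_add (μ.integrable _) (integrable_const _), μ.integral_const] at this
      have h2 : 0 ≤ ∫ y, (∫ x, φ x ∂μ.toMeasure + ψ y) ∂ν.toMeasure := integral_nonneg h1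
      have := ν.isProbabilityMeasure
      rw [integral_add (integrable_const _) (ν.integrable _), ν.integral_const] at h2
      simpa [dualValue] using h2
    · have := hD (-(t⁻¹ • φ), -(t⁻¹ • ψ)) fun x y => by
        have hxy := h x y
        calc ENNReal.ofReal (-(t⁻¹ * φ x) + -(t⁻¹ * ψ y))
            = ENNReal.ofReal (t⁻¹ * -(φ x + ψ y)) := by congr 1; ring
          _ = ENNReal.ofReal t⁻¹ * ENNReal.ofReal (-(φ x + ψ y)) :=
              ENNReal.ofReal_mul (by positivity)
          _ ≤ ENNReal.ofReal t⁻¹ * (ENNReal.ofReal t * d x y ^ 2) := by gcongr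
          _ = d x y ^ 2 := by
              rw [← mul_assoc, ← ENNReal.ofReal_mul (by positivity), inv_mul_cancel₀ ht.ne']
              simp
      have hval : dualValue μ ν (-(t⁻¹ • φ), -(t⁻¹ • ψ)) = -(t⁻¹ * dualValue μ ν (φ, ψ)) := by
        simp only [dualValue, BoundedContinuousFunction.coe_neg, Pi.neg_apply, integral_neg,
          BoundedContinuousFunction.coe_smul, smul_eq_mul, integral_const_mul]
        ring
      rw [hval] at this
      have h3 : t * (-(t⁻¹ * dualValue μ ν (φ, ψ))) ≤ t * D := by gcongr
      have h4 : t * (-(t⁻¹ * dualValue μ ν (φ, ψ))) = - dualValue μ ν (φ, ψ) := by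
        field_simp
      linarith) (by
    rintro ⟨φ, ψ, t, g⟩
    -- Adding this element leaves `‖g‖ + g`, which is nonnegative.
    refine ⟨⟨(BoundedContinuousFunction.const X ‖g‖ - φ, -ψ, -t, 0), (hdom _).2 rfl⟩, ?_⟩
    refine (hs _).2 ⟨by simp, fun x y => ?_⟩
    simp only [Prod.fst_add, Prod.snd_add, BoundedContinuousFunction.coe_add, Pi.add_apply,
      BoundedContinuousFunction.coe_sub, Pi.sub_apply, BoundedContinuousFunction.const_apply,
      BoundedContinuousFunction.coe_neg, Pi.neg_apply, zero_add]
    rw [ENNReal.ofReal_of_nonpos]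
    · exact bot_le
    · have := neg_le_of_abs_le (g.norm_coe_le_norm (x, y))
      linarith)
  refine ⟨G.comp ((LinearMap.inr ℝ (X →ᵇ ℝ) ((X →ᵇ ℝ) × ℝ × ((X × X) →ᵇ ℝ))).comp
    ((LinearMap.inr ℝ (X →ᵇ ℝ) (ℝ × ((X × X) →ᵇ ℝ))).comp
      (LinearMap.inr ℝ ℝ ((X × X) →ᵇ ℝ)))), fun h φ ψ t ht hle => ?_⟩
  have h1 : G (φ, ψ, t, 0) = dualValue μ ν (φ, ψ) + t * D :=
    hG ⟨(φ, ψ, t, 0), (hdom _).2 rfl⟩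
  have h2 : 0 ≤ G (φ, ψ, t, -h) := hGs _ ((hs _).2 ⟨ht, fun x y => by
    refine le_trans (le_of_eq ?_) (hle x y)
    congr 1
    simp only [BoundedContinuousFunction.coe_neg, Pi.neg_apply]
    ring⟩)
  have h3 : G (φ, ψ, t, -h) = G (φ, ψ, t, 0) - G (0, 0, 0, h) := by
    rw [← map_sub]
    congr 1
    simp
  change G (0, 0, 0, h) ≤ _
  linarith

theorem RadonProb.exists_isCompact_compl_le {X : Type*} [TopologicalSpace X] [T2Space X]
    (μ : RadonProb X) {ε : ℝ≥0∞} (hε : ε ≠ 0) :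
    ∃ K, IsCompact K ∧ μ.toMeasure Kᶜ ≤ ε := by
  let : MeasurableSpace X := borel X
  have : BorelSpace X := ⟨rfl⟩
  have := μ.isProbabilityMeasure
  have := μ.innerRegular
  obtain ⟨K, -, hK, h⟩ := MeasurableSet.univ.exists_isCompact_sdiff_lt (μ := μ.toMeasure)
    (measure_ne_top _ _) hε
  exact ⟨K, hK, by simpa [Set.compl_eq_univ_sdiff] using h.le⟩

theorem RadonProb.integral_le_of_eq_zero_on {X : Type*} [TopologicalSpace X] [T2Space X]
    (μ : RadonProb X) {K : Set X} (hK : IsCompact K) {ε : ℝ} (hε : 0 ≤ ε)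
    (h : μ.toMeasure Kᶜ ≤ ENNReal.ofReal ε) {g : X →ᵇ ℝ} (h0 : ∀ x, 0 ≤ g x)
    (h1 : ∀ x, g x ≤ 1) (hg : ∀ x ∈ K, g x = 0) : ∫ x, g x ∂μ.toMeasure ≤ ε := by
  let : MeasurableSpace X := borel X
  have : BorelSpace X := ⟨rfl⟩
  rw [← ENNReal.ofReal_le_ofReal_iff hε,
    ofReal_integral_eq_lintegral_ofReal (μ.integrable g) (ae_of_all _ h0)]
  refine le_trans ?_ h
  rw [← lintegral_indicator_one hK.measurableSet.compl]
  refine lintegral_mono fun x => ?_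
  by_cases hx : x ∈ K
  · simp [hx, hg x hx]
  · simpa [hx] using h1 x

/-- Kantorovich duality, hard direction: a bound on the dual problem bounds the primal one. -/
theorem wassersteinSq_le_of_dual_le {X : Type*} [TopologicalSpace X] {d : X → X → ℝ≥0∞}
    (hd : IsExtendedMetricTopological d) (μ ν : RadonProb X) {D : ℝ}
    (hD : ∀ q ∈ dualPairs d, dualValue μ ν q ≤ D) :
    wassersteinSq d μ ν ≤ ENNReal.ofReal D := by
  have := hd.t35Space
  obtain ⟨Λ, hΛ⟩ := exists_dual_functional μ ν hD
  let pr1 : (X →ᵇ ℝ) → ((X × X) →ᵇ ℝ) := fun φ => φ.compContinuous ⟨Prod.fst, continuous_fst⟩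
  let pr2 : (X →ᵇ ℝ) → ((X × X) →ᵇ ℝ) := fun φ => φ.compContinuous ⟨Prod.snd, continuous_snd⟩
  have hzero : dualValue μ ν (0, 0) = 0 := by simp [dualValue]
  have hΛ0 : ∀ (h : (X × X) →ᵇ ℝ) (φ ψ : X →ᵇ ℝ), (∀ x y, h (x, y) ≤ φ x + ψ y) →
      Λ h ≤ dualValue μ ν (φ, ψ) := fun h φ ψ hle => by
    have := hΛ h φ ψ 0 le_rfl fun x y => by
      rw [ENNReal.ofReal_of_nonpos (by linarith [hle x y])]; exact bot_le
    simpa using this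
  have hpos : ∀ g : (X × X) →ᵇ ℝ, (∀ y, 0 ≤ g y) → 0 ≤ Λ g := fun g hg => by
    have := hΛ0 (-g) 0 0 fun x y => by simpa using hg (x, y)
    rw [hzero, map_neg] at this
    linarith
  have hm1 : ∀ φ : X →ᵇ ℝ, Λ (pr1 φ) = ∫ x, φ x ∂μ.toMeasure := fun φ => by
    have h1 := hΛ0 (pr1 φ) φ 0 fun x y => by simp [pr1]
    have h2 := hΛ0 (-pr1 φ) (-φ) 0 fun x y => by simp [pr1]
    simp only [dualValue, BoundedContinuousFunction.coe_zero, Pi.zero_apply, integral_zero,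
      add_zero, map_neg, BoundedContinuousFunction.coe_neg, Pi.neg_apply, integral_neg] at h1 h2
    linarith
  have hm2 : ∀ φ : X →ᵇ ℝ, Λ (pr2 φ) = ∫ x, φ x ∂ν.toMeasure := fun φ => by
    have h1 := hΛ0 (pr2 φ) 0 φ fun x y => by simp [pr2]
    have h2 := hΛ0 (-pr2 φ) 0 (-φ) fun x y => by simp [pr2]
    simp only [dualValue, BoundedContinuousFunction.coe_zero, Pi.zero_apply, integral_zero,
      zero_add, map_neg, BoundedContinuousFunction.coe_neg, Pi.neg_apply, integral_neg] at h1 h2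
    linarith
  have hone : Λ (BoundedContinuousFunction.const (X × X) 1) = 1 := by
    have := hm1 (BoundedContinuousFunction.const X 1)
    simp only [BoundedContinuousFunction.const_apply, μ.integral_const] at this
    exact this
  have htight : ∀ ε : ℝ, 0 < ε → ∃ K : Set (X × X), IsCompact K ∧ ∀ g : (X × X) →ᵇ ℝ,
      (∀ y, 0 ≤ g y) → (∀ y, g y ≤ 1) → (∀ y ∈ K, g y = 0) → Λ g ≤ ε := by
    intro ε hε
    obtain ⟨K₁, hK₁, h₁⟩ := μ.exists_isCompact_compl_le (ε := ENNReal.ofReal (ε / 3))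
      (by simpa using hε)
    obtain ⟨K₂, hK₂, h₂⟩ := ν.exists_isCompact_compl_le (ε := ENNReal.ofReal (ε / 3))
      (by simpa using hε)
    refine ⟨K₁ ×ˢ K₂, hK₁.prod hK₂, fun g hg0 hg1 hgK => ?_⟩
    -- Inside the tube `g` is below `ε / 3`; outside it `φ + ψ ≥ 1 ≥ g`. Hence `g ≤ ε / 3 + φ + ψ`,
    -- and the marginals bound the last two terms.
    obtain ⟨U, V, hU, hV, hKU, hKV, hUV⟩ := generalized_tube_lemma hK₁ hK₂
      (n := {p | g p < ε / 3}) (isOpen_lt g.continuous continuous_const)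
      (fun p hp => by
        change g p < ε / 3
        rw [hgK p hp]; positivity)
    obtain ⟨φ, hφ0, hφ1, hφK, hφU⟩ := exists_bounded_separation hK₁ hU hKU
    obtain ⟨ψ, hψ0, hψ1, hψK, hψV⟩ := exists_bounded_separation hK₂ hV hKV
    have hle := hΛ0 g (BoundedContinuousFunction.const X (ε / 3) + φ) ψ fun x y => by
      simp only [BoundedContinuousFunction.coe_add, Pi.add_apply,
        BoundedContinuousFunction.const_apply]
      by_cases hx : x ∈ U
      · by_cases hy : y ∈ V
        · have : g (x, y) < ε / 3 := hUV ⟨hx, hy⟩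
          linarith [hφ0 x, hψ0 y]
        · linarith [hφ0 x, hψV y hy, hg1 (x, y)]
      · linarith [hφU x hx, hψ0 y, hg1 (x, y)]
    have i1 := μ.integral_le_of_eq_zero_on hK₁ (by positivity) h₁ hφ0 hφ1 hφK
    have i2 := ν.integral_le_of_eq_zero_on hK₂ (by positivity) h₂ hψ0 hψ1 hψK
    have := μ.isProbabilityMeasure
    simp only [dualValue, BoundedContinuousFunction.coe_add, Pi.add_apply,
      BoundedContinuousFunction.const_apply] at hle
    rw [integral_add (integrable_const _) (μ.integrable _), μ.integral_const] at hle
    linarith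
  let : MeasurableSpace X := borel X
  have : BorelSpace X := ⟨rfl⟩
  let : MeasurableSpace (X × X) := borel (X × X)
  have : BorelSpace (X × X) := ⟨rfl⟩
  obtain ⟨π, hπ, hπr, hπΛ⟩ := exists_measure_of_tight_functional Λ hpos hone htight
  have := μ.isProbabilityMeasure
  have := ν.isProbabilityMeasure
  have : IsProbabilityMeasure (π.map Prod.fst) :=
    Measure.isProbabilityMeasure_map measurable_fst_borel.aemeasurable
  have : IsProbabilityMeasure (π.map Prod.snd) :=
    Measure.isProbabilityMeasure_map measurable_snd_borel.aemeasurable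
  have hfst : π.map Prod.fst = μ.toMeasure := by
    refine measure_eq_of_forall_integral_eq
      (Measure.InnerRegular.map_of_continuous continuous_fst) μ.innerRegular fun g => ?_
    rw [← hm1, hπΛ, integral_map measurable_fst_borel.aemeasurable
      g.continuous.aestronglyMeasurable]
    rfl
  have hsnd : π.map Prod.snd = ν.toMeasure := by
    refine measure_eq_of_forall_integral_eq
      (Measure.InnerRegular.map_of_continuous continuous_snd) ν.innerRegular fun g => ?_
    rw [← hm2, hπΛ, integral_map measurable_snd_borel.aemeasurable
      g.continuous.aestronglyMeasurable]
    rfl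
  refine (iInf₂_le (⟨π, hπ, hπr⟩ : RadonProb (X × X)) ⟨hfst, hsnd⟩).trans ?_
  change ∫⁻ p, d p.1 p.2 ^ 2 ∂π ≤ _
  simp_rw [← iSup_costMinorants hd]
  have : Nonempty (costMinorants d) := ⟨⟨0, fun x y => by simp⟩⟩
  refine lintegral_iSup_le_of_directed π _
    (fun h => (ENNReal.continuous_ofReal.comp h.1.continuous).lowerSemicontinuous) (directed_costMinorants d)
    fun h => ?_
  have heq : ∀ p, ENNReal.ofReal (h.1 p) = ENNReal.ofReal ((h.1 ⊔ 0) p) := fun p => by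
    simp [ENNReal.ofReal_max]
  change ∫⁻ p, ENNReal.ofReal (h.1 p) ∂π ≤ _
  rw [lintegral_congr heq, ← ofReal_integral_eq_lintegral_ofReal ((h.1 ⊔ 0).integrable π)
    (ae_of_all _ fun p => by simp), ← hπΛ]
  refine ENNReal.ofReal_le_ofReal ?_
  -- Zero potentials and one unit of cost: the functional of any minorant of the cost is at most
  -- `D`.
  have := hΛ (h.1 ⊔ 0) 0 0 1 zero_le_one fun x y => by
    have := h.2 x y
    rw [heq] at this
    simpa using this
  simpa [hzero] using this

/-- Kantorovich duality. -/
theorem wassersteinSq_eq_iSup_dualValue {X : Type*} [TopologicalSpace X] {d : X → X → ℝ≥0∞}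
    (hd : IsExtendedMetricTopological d) (μ ν : RadonProb X) :
    wassersteinSq d μ ν = ⨆ q : dualPairs d, ENNReal.ofReal (dualValue μ ν q) := by
  refine le_antisymm ?_ (iSup_le fun q => dualValue_le_wassersteinSq μ ν q.2)
  by_cases htop : ⨆ q : dualPairs d, ENNReal.ofReal (dualValue μ ν q) = ∞
  · rw [htop]; exact le_top
  · refine (wassersteinSq_le_of_dual_le hd μ ν (D := (⨆ q : dualPairs d,
      ENNReal.ofReal (dualValue μ ν q)).toReal) fun q hq => ?_).trans
      ENNReal.ofReal_toReal_le
    rw [← ENNReal.ofReal_le_iff_le_toReal htop]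
    exact le_iSup (fun q : dualPairs d => ENNReal.ofReal (dualValue μ ν q)) ⟨q, hq⟩

/-! ### Entropy bounds and tightness -/

open Classical in
/-- The weight `exp (-V)`, with `exp (-∞) = 0`. -/
noncomputable def expWeight {X : Type*} (V : X → ℝ≥0∞) (x : X) : ℝ≥0∞ :=
  if V x = ∞ then 0 else ENNReal.ofReal (Real.exp (-(V x).toReal))

theorem measure_le_lt_top_of_expWeight {X : Type*} [MeasurableSpace X] {m : Measure X}
    {V : X → ℝ≥0∞} (hV : Measurable V) (hZ : ∫⁻ x, expWeight V x ∂m < ∞) (R : ℝ) :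
    m {x | V x ≤ ENNReal.ofReal R} < ∞ := by
  have hw : ∀ x ∈ {x | V x ≤ ENNReal.ofReal R},
      ENNReal.ofReal (Real.exp (-max R 0)) ≤ expWeight V x := by
    intro x hx
    have hx : V x ≤ ENNReal.ofReal R := hx
    have hne : V x ≠ ∞ := (hx.trans_lt ENNReal.ofReal_lt_top).ne
    rw [expWeight, if_neg hne]
    refine ENNReal.ofReal_le_ofReal (Real.exp_le_exp.2 (neg_le_neg ?_))
    have := ENNReal.toReal_mono ENNReal.ofReal_ne_top hx
    rwa [ENNReal.toReal_ofReal'] at this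
  have hmeas : MeasurableSet {x | V x ≤ ENNReal.ofReal R} := measurableSet_le hV measurable_const
  have h1 : ENNReal.ofReal (Real.exp (-max R 0)) * m {x | V x ≤ ENNReal.ofReal R} ≤
      ∫⁻ x, expWeight V x ∂m := by
    rw [← setLIntegral_const]
    exact (setLIntegral_mono' hmeas hw).trans (setLIntegral_le_lintegral _ _)
  exact ENNReal.lt_top_of_mul_ne_top_right (h1.trans_lt hZ).ne
    (by simpa using Real.exp_pos _)

/-- Sublevel sets of `V` have finite `m`-measure and `ν` lives on `{V < ∞}`, where `m` is therefore
σ-finite. Without a decomposition `rnDeriv` would be zero by default and the entropy formula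
meaningless. -/
theorem haveLebesgueDecomposition_of_expWeight {X : Type*} [MeasurableSpace X] {m ν : Measure X}
    [IsFiniteMeasure ν] {V : X → ℝ≥0∞} (hV : Measurable V) (hZ : ∫⁻ x, expWeight V x ∂m < ∞)
    (hνV : ∫⁻ x, V x ∂ν ≠ ∞) (hν : ν ≪ m) : ν.HaveLebesgueDecomposition m := by
  let S : Set X := {x | V x < ∞}
  have hS : MeasurableSet S := measurableSet_lt hV measurable_const
  have hνS : ν Sᶜ = 0 := ae_lt_top hV hνV
  have hσ : SigmaFinite (m.restrict S) := by
    refine Measure.sigmaFinite_of_countable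
      (S := insert Sᶜ (Set.range fun n : ℕ => {x | V x ≤ ENNReal.ofReal n}))
      ((Set.countable_range _).insert _) ?_ ?_
    · rintro s (rfl | ⟨n, rfl⟩)
      · rw [Measure.restrict_apply hS.compl]; simp
      · exact (Measure.restrict_apply_le _ _).trans_lt (measure_le_lt_top_of_expWeight hV hZ n)
    · refine Set.eq_univ_of_forall fun x => ?_
      by_cases hx : x ∈ S
      · obtain ⟨n, hn⟩ := ENNReal.exists_nat_gt (show V x ≠ ∞ from ne_of_lt hx)
        exact ⟨_, Or.inr ⟨n, rfl⟩, show V x ≤ ENNReal.ofReal n by simpa using hn.le⟩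
      · exact ⟨_, Or.inl rfl, hx⟩
  have hac : ν ≪ m.restrict S := by
    refine Measure.AbsolutelyContinuous.mk fun s hs h0 => ?_
    rw [Measure.restrict_apply hs] at h0
    refine le_antisymm ?_ bot_le
    calc ν s ≤ ν (s ∩ S) + ν (s \ S) := measure_le_inter_add_sdiff _ _ _
      _ ≤ 0 + ν Sᶜ := add_le_add (hν h0).le (measure_mono fun x hx => hx.2)
      _ = 0 := by rw [hνS, add_zero]
  refine ⟨⟨0, S.indicator (ν.rnDeriv (m.restrict S))⟩,
    (Measure.measurable_rnDeriv _ _).indicator hS, .zero_left, ?_⟩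
  rw [zero_add, withDensity_indicator hS, Measure.withDensity_rnDeriv_eq _ _ hac]

/-- This is `log x ≤ x - 1` at `x = exp (-v) / r`, multiplied by `r`. -/
theorem neg_mul_log_le {r : ℝ} (v : ℝ) (hr : 0 ≤ r) :
    -(r * Real.log r) ≤ Real.exp (-v) + r * v := by
  rcases hr.eq_or_lt with rfl | hr
  · simpa using (Real.exp_pos _).le
  · have h1 : Real.log (Real.exp (-v) / r) ≤ Real.exp (-v) / r - 1 :=
      Real.log_le_sub_one_of_pos (by positivity)
    rw [Real.log_div (Real.exp_pos _).ne' hr.ne', Real.log_exp] at h1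
    have h2 : r * (-v - Real.log r) ≤ r * (Real.exp (-v) / r - 1) := by gcongr
    have h3 : r * (Real.exp (-v) / r - 1) = Real.exp (-v) - r := by field_simp
    nlinarith

/-- The negative part of the entropy is controlled by an exponential weight. -/
theorem lintegral_neg_mul_log_le {X : Type*} [MeasurableSpace X] {m ν : Measure X}
    [IsFiniteMeasure ν] {V : X → ℝ≥0∞} (hV : Measurable V) [ν.HaveLebesgueDecomposition m]
    (hν : ν ≪ m) :
    ∫⁻ x, ENNReal.ofReal (-((ν.rnDeriv m x).toReal * Real.log (ν.rnDeriv m x).toReal)) ∂m ≤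
      ∫⁻ x, expWeight V x ∂m + ∫⁻ x, V x ∂ν := by
  have hmeas : Measurable fun x => ν.rnDeriv m x * V x := (Measure.measurable_rnDeriv _ _).mul hV
  rw [← lintegral_rnDeriv_mul hν hV.aemeasurable, ← lintegral_add_right _ hmeas]
  refine lintegral_mono_ae ?_
  filter_upwards [Measure.rnDeriv_lt_top ν m] with x hx
  by_cases hVx : V x = ∞
  · rw [hVx, expWeight, if_pos hVx, zero_add]
    by_cases h0 : ν.rnDeriv m x = 0
    · simp [h0]
    · rw [ENNReal.mul_top h0]; exact le_top
  · rw [expWeight, if_neg hVx]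
    calc _ ≤ ENNReal.ofReal (Real.exp (-(V x).toReal) + (ν.rnDeriv m x).toReal * (V x).toReal) :=
          ENNReal.ofReal_le_ofReal (neg_mul_log_le _ ENNReal.toReal_nonneg)
      _ = _ := by
          rw [ENNReal.ofReal_add (Real.exp_pos _).le (by positivity),
            ENNReal.ofReal_mul ENNReal.toReal_nonneg, ENNReal.ofReal_toReal hx.ne,
            ENNReal.ofReal_toReal hVx]

/-- Uniform integrability: the density is at most `exp l`, or its logarithm is at least `l` and the
density is at most `l⁻¹` times the entropy integrand. -/
theorem measure_le_of_mul_log {X : Type*} [MeasurableSpace X] {m ν : Measure X}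
    [IsFiniteMeasure ν] [ν.HaveLebesgueDecomposition m] (hν : ν ≪ m) {l : ℝ} (hl : 0 < l)
    {A : Set X} (hA : MeasurableSet A) :
    ν A ≤ ENNReal.ofReal (Real.exp l) * m A + ENNReal.ofReal l⁻¹ *
      ∫⁻ x, ENNReal.ofReal ((ν.rnDeriv m x).toReal * Real.log (ν.rnDeriv m x).toReal) ∂m := by
  calc ν A = ∫⁻ x in A, ν.rnDeriv m x ∂m := (Measure.setLIntegral_rnDeriv' hν hA).symm
    _ ≤ ∫⁻ x in A, (ENNReal.ofReal (Real.exp l) + ENNReal.ofReal l⁻¹ *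
        ENNReal.ofReal ((ν.rnDeriv m x).toReal * Real.log (ν.rnDeriv m x).toReal)) ∂m := by
        refine lintegral_mono_ae (ae_restrict_of_ae ?_)
        filter_upwards [Measure.rnDeriv_lt_top ν m] with x hx
        set r := (ν.rnDeriv m x).toReal with hr
        rw [← ENNReal.ofReal_toReal hx.ne, ← hr]
        rcases le_total r (Real.exp l) with h | h
        · exact (ENNReal.ofReal_le_ofReal h).trans le_self_add
        · refine le_trans ?_ le_add_self
          rw [← ENNReal.ofReal_mul (by positivity)]
          refine ENNReal.ofReal_le_ofReal ?_
          have h0 : 0 < r := (Real.exp_pos l).trans_le h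
          have h1 : l ≤ Real.log r := (Real.le_log_iff_exp_le h0).2 h
          calc r = l⁻¹ * (r * l) := by field_simp
            _ ≤ l⁻¹ * (r * Real.log r) := by gcongr
    _ = ENNReal.ofReal (Real.exp l) * m A + ENNReal.ofReal l⁻¹ * ∫⁻ x in A,
        ENNReal.ofReal ((ν.rnDeriv m x).toReal * Real.log (ν.rnDeriv m x).toReal) ∂m := by
        rw [lintegral_add_left measurable_const, setLIntegral_const,
          lintegral_const_mul' _ _ ENNReal.ofReal_ne_top]
    _ ≤ _ := add_le_add le_rfl (mul_le_mul' le_rfl (setLIntegral_le_lintegral _ _))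

theorem lintegral_pos_le_of_relEntropy_le {X : Type*} [TopologicalSpace X]
    {m : @Measure X (borel X)} {ν : RadonProb X} {C : ℝ} (hC : 0 ≤ C)
    (h : relEntropy m ν ≤ C)
    (hN : ∫⁻ x, ENNReal.ofReal (-((ν.toMeasure.rnDeriv m x).toReal *
      Real.log (ν.toMeasure.rnDeriv m x).toReal)) ∂m ≠ ∞) :
    ν.toMeasure ≪ m ∧ ∫⁻ x, ENNReal.ofReal ((ν.toMeasure.rnDeriv m x).toReal *
      Real.log (ν.toMeasure.rnDeriv m x).toReal) ∂m ≤ ENNReal.ofReal C +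
      ∫⁻ x, ENNReal.ofReal (-((ν.toMeasure.rnDeriv m x).toReal *
      Real.log (ν.toMeasure.rnDeriv m x).toReal)) ∂m := by
  unfold relEntropy at h
  split_ifs at h with hac
  swap
  · exact absurd h (by simp)
  refine ⟨hac, ?_⟩
  unfold extIntegral at h
  split_ifs at h with htop
  · exact absurd h (by simp)
  simp only [← EReal.coe_neg, EReal.real_coe_toENNReal] at h htop
  set P := ∫⁻ x, ENNReal.ofReal ((ν.toMeasure.rnDeriv m x).toReal *
      Real.log (ν.toMeasure.rnDeriv m x).toReal) ∂m
  set N := ∫⁻ x, ENNReal.ofReal (-((ν.toMeasure.rnDeriv m x).toReal *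
      Real.log (ν.toMeasure.rnDeriv m x).toReal)) ∂m
  clear_value P N
  lift P to ℝ≥0 using htop
  lift N to ℝ≥0 using hN
  rw [← ENNReal.toReal_le_toReal (by simp) (by simp), ENNReal.toReal_add (by simp) (by simp),
    ENNReal.toReal_ofReal hC]
  rw [EReal.coe_nnreal_eq_coe_real, EReal.coe_nnreal_eq_coe_real, ← EReal.coe_sub,
    EReal.coe_le_coe_iff] at h
  simp only [ENNReal.coe_toReal]
  linarith

/-- The complement of `K` is split by a sublevel set of `V`. Markov's inequality handles the part
outside it; inside, `K` has small `m`-complement and uniform integrability transfers this to `ν`. -/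
theorem exists_isCompact_of_relEntropy_le {X : Type*} [TopologicalSpace X] [T2Space X]
    {m : @Measure X (borel X)} (hm : @Measure.InnerRegular X (borel X) _ m) {V : X → ℝ≥0∞}
    (hV : @Measurable X _ (borel X) _ V) (hZ : ∫⁻ x, expWeight V x ∂m < ∞)
    {C M ε : ℝ} (hC : 0 ≤ C) (hM : 0 ≤ M) (hε : 0 < ε) :
    ∃ K : Set X, IsCompact K ∧ ∀ ν : RadonProb X, ∫⁻ x, V x ∂ν.toMeasure ≤ ENNReal.ofReal M →
      relEntropy m ν ≤ C → ν.toMeasure Kᶜ ≤ ENNReal.ofReal ε := by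
  let : MeasurableSpace X := borel X
  have : BorelSpace X := ⟨rfl⟩
  set Z := (∫⁻ x, expWeight V x ∂m).toReal with hZdef
  have hZ0 : 0 ≤ Z := ENNReal.toReal_nonneg
  have hZeq : ∫⁻ x, expWeight V x ∂m = ENNReal.ofReal Z := (ENNReal.ofReal_toReal hZ.ne).symm
  -- Each of three errors is to be at most `ε / 3`: `M / R` from Markov, `(C + Z + M) / l` from
  -- large densities, `exp l * δ` from small ones. None of the constants depends on `ν`.
  set R := 3 * (M + 1) / ε with hR
  have hRpos : 0 < R := by positivity
  set l := 3 * (C + Z + M + 1) / ε with hl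
  have hlpos : 0 < l := by positivity
  set δ := ε / 3 / Real.exp l with hδ
  have hδpos : 0 < δ := by positivity
  have hmeas : MeasurableSet {x | V x ≤ ENNReal.ofReal R} := measurableSet_le hV measurable_const
  obtain ⟨K, hKR, hK, hKδ⟩ := hmeas.exists_isCompact_sdiff_lt (μ := m)
    (measure_le_lt_top_of_expWeight hV hZ R).ne (ε := ENNReal.ofReal δ) (by simpa using hδpos)
  refine ⟨K, hK, fun ν hνV hνE => ?_⟩
  have hprob := ν.isProbabilityMeasure
  have hac : ν.toMeasure ≪ m := by
    by_contra hac
    rw [relEntropy, if_neg hac] at hνE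
    exact absurd hνE (by simp)
  have hLD := haveLebesgueDecomposition_of_expWeight hV hZ
    (hνV.trans_lt ENNReal.ofReal_lt_top).ne hac
  have hN := lintegral_neg_mul_log_le (m := m) (ν := ν.toMeasure) hV hac
  have hN' := hN.trans (add_le_add hZeq.le hνV)
  rw [← ENNReal.ofReal_add hZ0 hM] at hN'
  obtain ⟨-, hP⟩ := lintegral_pos_le_of_relEntropy_le hC hνE
    (hN'.trans_lt ENNReal.ofReal_lt_top).ne
  have hP' := hP.trans (add_le_add le_rfl hN')
  rw [← ENNReal.ofReal_add hC (by positivity)] at hP'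
  have h1 : ν.toMeasure {x | V x ≤ ENNReal.ofReal R}ᶜ ≤ ENNReal.ofReal (ε / 3) := by
    have hle : ENNReal.ofReal R * ν.toMeasure {x | V x ≤ ENNReal.ofReal R}ᶜ ≤
        ENNReal.ofReal M := by
      rw [← setLIntegral_const]
      refine le_trans ((setLIntegral_mono' hmeas.compl fun x hx => ?_).trans
        (setLIntegral_le_lintegral _ _)) hνV
      exact (not_le.1 (show ¬V x ≤ ENNReal.ofReal R from hx)).le
    rw [mul_comm, ← ENNReal.le_div_iff_mul_le (by simp [hRpos]) (by simp),
      ← ENNReal.ofReal_div_of_pos hRpos] at hle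
    refine hle.trans (ENNReal.ofReal_le_ofReal ?_)
    rw [div_le_iff₀ hRpos, hR]
    field_simp
    linarith
  have h2 := measure_le_of_mul_log (m := m) (ν := ν.toMeasure) hac hlpos
    (hmeas.diff hK.measurableSet)
  have h3 : ENNReal.ofReal (Real.exp l) * m ({x | V x ≤ ENNReal.ofReal R} \ K) ≤
      ENNReal.ofReal (ε / 3) := by
    calc _ ≤ ENNReal.ofReal (Real.exp l) * ENNReal.ofReal δ := by gcongr
      _ = ENNReal.ofReal (ε / 3) := by
          rw [← ENNReal.ofReal_mul (Real.exp_pos _).le, hδ]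
          congr 1
          field_simp
  have h4 : ENNReal.ofReal l⁻¹ * ∫⁻ x, ENNReal.ofReal ((ν.toMeasure.rnDeriv m x).toReal *
      Real.log (ν.toMeasure.rnDeriv m x).toReal) ∂m ≤ ENNReal.ofReal (ε / 3) := by
    calc _ ≤ ENNReal.ofReal l⁻¹ * ENNReal.ofReal (C + (Z + M)) := by gcongr
      _ ≤ ENNReal.ofReal (ε / 3) := by
          rw [← ENNReal.ofReal_mul (by positivity)]
          refine ENNReal.ofReal_le_ofReal ?_
          rw [inv_mul_le_iff₀ hlpos, hl]
          field_simp
          linarith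
  calc ν.toMeasure Kᶜ ≤ ν.toMeasure ({x | V x ≤ ENNReal.ofReal R}ᶜ ∪
        ({x | V x ≤ ENNReal.ofReal R} \ K)) := measure_mono fun x hx => by
        by_cases h : x ∈ {x | V x ≤ ENNReal.ofReal R}
        · exact Or.inr ⟨h, hx⟩
        · exact Or.inl h
    _ ≤ ENNReal.ofReal (ε / 3) + (ENNReal.ofReal (ε / 3) + ENNReal.ofReal (ε / 3)) :=
        (measure_union_le _ _).trans (add_le_add h1 (h2.trans (add_le_add h3 h4)))
    _ = ENNReal.ofReal ε := by
        rw [← ENNReal.ofReal_add (by positivity) (by positivity),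
          ← ENNReal.ofReal_add (by positivity) (by positivity)]
        congr 1
        ring

/-! ### Finitely supported approximations -/

/-- An arbitrary function exceeds a measurable minorant with the same lower integral by at most
one on a set of full outer measure. -/
theorem exists_measurable_minorant {P : Type*} [MeasurableSpace P] {Ω : Measure P}
    {h : P → ℝ≥0∞} (hh : ∫⁻ μ, h μ ∂Ω ≠ ∞) :
    ∃ g : P → ℝ≥0∞, Measurable g ∧ ∫⁻ μ, g μ ∂Ω < ∞ ∧
      ∀ M : Set P, MeasurableSet M → {μ | h μ ≤ g μ + 1} ⊆ M → Ω Mᶜ = 0 := by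
  obtain ⟨g, hg, hgh, hint⟩ := exists_measurable_le_lintegral_eq Ω h
  refine ⟨g, hg, hint ▸ hh.lt_top, fun M hM hAM => ?_⟩
  -- If `Mᶜ` had positive mass, this minorant of `h` would have an integral above the lower integral
  -- of `h`.
  have hle : ∀ μ, g μ + Mᶜ.indicator 1 μ ≤ h μ := fun μ => by
    by_cases hμ : μ ∈ M
    · simpa [hμ] using hgh μ
    · have : ¬h μ ≤ g μ + 1 := fun h' => hμ (hAM h')
      simpa [hμ] using (not_le.1 this).le
  have h1 : ∫⁻ μ, g μ ∂Ω + Ω Mᶜ ≤ ∫⁻ μ, g μ ∂Ω := by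
    rw [← lintegral_indicator_one hM.compl, ← lintegral_add_left hg]
    exact (lintegral_mono hle).trans hint.le
  rw [hint] at hh
  by_contra hne
  exact absurd h1 (not_le.2 (ENNReal.lt_add_right hh hne))

/-- Finitely many integrals against a probability measure can be approximated, up to an error
and by a finitely supported probability measure living on a set of full outer measure. -/
theorem exists_finite_average {P : Type*} [MeasurableSpace P] [MeasurableSingletonClass P]
    (Ω : Measure P) [IsProbabilityMeasure Ω] {A : Set P}
    (hA : ∀ M : Set P, MeasurableSet M → A ⊆ M → Ω Mᶜ = 0) (s : Finset (P → ℝ≥0∞))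
    (hs : ∀ h ∈ s, Measurable h ∧ ∫⁻ μ, h μ ∂Ω < ∞) {ε : ℝ} (hε : 0 < ε) :
    ∃ Ω' : Measure P, IsProbabilityMeasure Ω' ∧ (∃ S : Set P, S.Finite ∧ Ω' Sᶜ = 0) ∧
      Ω' Aᶜ = 0 ∧ ∀ h ∈ s, ∫⁻ μ, h μ ∂Ω' ≤ ∫⁻ μ, h μ ∂Ω + ENNReal.ofReal ε := by
  let G : P → (s → ℝ) := fun μ h => (h.1 μ).toReal
  have hGm : Measurable G := measurable_pi_iff.2 fun h => (hs h.1 h.2).1.ennreal_toReal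
  have hGi : Integrable G Ω := Integrable.of_eval fun h =>
    integrable_toReal_of_lintegral_ne_top (hs h.1 h.2).1.aemeasurable (hs h.1 h.2).2.ne
  let B : Set P := {μ | ∀ h : s, h.1 μ < ∞}
  have hBm : MeasurableSet B := by
    have : B = ⋂ h : s, {μ | h.1 μ < ∞} := by ext; simp [B]
    rw [this]
    exact MeasurableSet.iInter fun h => measurableSet_lt (hs h.1 h.2).1 measurable_const
  have hB : ∀ᵐ μ ∂Ω, μ ∈ B :=
    ae_all_iff.2 fun h => ae_lt_top (hs h.1 h.2).1 (hs h.1 h.2).2.ne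
  -- `A` need not be measurable, but the preimage of this closed hull, together with `Bᶜ`, is a
  -- measurable set containing `A`, hence of full measure.
  have hmem : ∫ μ, G μ ∂Ω ∈ closure (convexHull ℝ (G '' (A ∩ B))) := by
    refine (convex_convexHull ℝ _).closure.integral_mem isClosed_closure ?_ hGi
    have h1 : Ω (G ⁻¹' closure (convexHull ℝ (G '' (A ∩ B))) ∪ Bᶜ)ᶜ = 0 := by
      refine hA _ ((hGm isClosed_closure.measurableSet).union hBm.compl) fun μ hμ => ?_
      by_cases hμB : μ ∈ B
      · exact Or.inl (subset_closure (subset_convexHull ℝ _ ⟨μ, ⟨hμ, hμB⟩, rfl⟩))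
      · exact Or.inr hμB
    filter_upwards [measure_eq_zero_iff_ae_notMem.1 h1, hB] with μ h2 h3
    by_contra h4
    exact h2 fun h5 => h5.elim h4 fun h6 => h6 h3
  obtain ⟨v, hv, hdist⟩ := Metric.mem_closure_iff.1 hmem ε hε
  obtain ⟨ι, _, w, z, hw0, hw1, hz, rfl⟩ := mem_convexHull_iff_exists_fintype.1 hv
  choose μ hμ hμz using hz
  let Ω' : Measure P := ∑ i, ENNReal.ofReal (w i) • Measure.dirac (μ i)
  have hint : ∀ h : P → ℝ≥0∞, ∫⁻ x, h x ∂Ω' = ∑ i, ENNReal.ofReal (w i) * h (μ i) := fun h => by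
    simp [Ω', lintegral_finsetSum_measure, lintegral_smul_measure]
  have hnull : ∀ S : Set P, (∀ i, μ i ∈ S) → Ω' Sᶜ = 0 := fun S hS => by
    simp [Ω', hS]
  refine ⟨Ω', ⟨?_⟩, ⟨Set.range μ, Set.finite_range μ, hnull _ fun i => ⟨i, rfl⟩⟩,
    hnull A fun i => (hμ i).1, fun h hh => ?_⟩
  · simp only [Ω', Measure.coe_finsetSum, Finset.sum_apply, Measure.smul_apply, measure_univ,
      smul_eq_mul, mul_one]
    rw [← ENNReal.ofReal_sum_of_nonneg fun i _ => hw0 i, hw1, ENNReal.ofReal_one]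
  · have hfin : ∀ i, h (μ i) ≠ ∞ := fun i => ((hμ i).2 ⟨h, hh⟩).ne
    have h1 : ∫⁻ x, h x ∂Ω' = ENNReal.ofReal (∑ i, w i * (h (μ i)).toReal) := by
      rw [hint, ENNReal.ofReal_sum_of_nonneg fun i _ => mul_nonneg (hw0 i) ENNReal.toReal_nonneg]
      refine Finset.sum_congr rfl fun i _ => ?_
      rw [ENNReal.ofReal_mul (hw0 i), ENNReal.ofReal_toReal (hfin i)]
    have h2 : (∫ x, G x ∂Ω) ⟨h, hh⟩ = (∫⁻ x, h x ∂Ω).toReal := by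
      rw [eval_integral fun h => hGi.eval h]
      exact integral_toReal (hs h hh).1.aemeasurable (ae_lt_top (hs h hh).1 (hs h hh).2.ne)
    have h3 : (∑ i, w i • z i) ⟨h, hh⟩ = ∑ i, w i * (h (μ i)).toReal := by
      simp [← hμz, G]
    have h4 := (dist_le_pi_dist (∫ x, G x ∂Ω) (∑ i, w i • z i) ⟨h, hh⟩).trans hdist.le
    rw [h2, h3, Real.dist_eq, abs_le] at h4
    rw [h1, ← ENNReal.ofReal_toReal (hs h hh).2.ne, ← ENNReal.ofReal_add ENNReal.toReal_nonneg hε.le]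
    exact ENNReal.ofReal_le_ofReal (by linarith [h4.1])

/-! ### Narrow limits and semicontinuity -/

/-- A family of Radon probability measures that is tight along an ultrafilter converges narrowly
to a Radon probability measure. -/
theorem exists_narrow_limit {X I : Type*} [TopologicalSpace X] [T35Space X]
    (ν : I → RadonProb X) (F : Ultrafilter I)
    (htight : ∀ ε : ℝ, 0 < ε → ∃ K : Set X, IsCompact K ∧
      ∀ i, (ν i).toMeasure Kᶜ ≤ ENNReal.ofReal ε) :
    ∃ ν' : RadonProb X, ∀ g : X →ᵇ ℝ,
      Tendsto (fun i => ∫ x, g x ∂(ν i).toMeasure) F (𝓝 (∫ x, g x ∂ν'.toMeasure)) := by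
  have hbound : ∀ (g : X →ᵇ ℝ) (i : I), |∫ x, g x ∂(ν i).toMeasure| ≤ ‖g‖ := fun g i => by
    have := (ν i).isProbabilityMeasure
    simpa using norm_integral_le_of_norm_le_const (μ := (ν i).toMeasure)
      (ae_of_all _ fun x => g.norm_coe_le_norm x)
  have hlim : ∀ g : X →ᵇ ℝ, ∃ a : ℝ, Tendsto (fun i => ∫ x, g x ∂(ν i).toMeasure) F (𝓝 a) := by
    intro g
    obtain ⟨a, -, ha⟩ := (isCompact_Icc (a := -‖g‖) (b := ‖g‖)).ultrafilter_le_nhds'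
      (F.map fun i => ∫ x, g x ∂(ν i).toMeasure)
      (Ultrafilter.mem_map.2 (Filter.univ_mem' fun i => abs_le.1 (hbound g i)))
    exact ⟨a, ha⟩
  choose Λ hΛ using hlim
  let L : (X →ᵇ ℝ) →ₗ[ℝ] ℝ :=
    { toFun := Λ
      map_add' := fun g g' => by
        refine tendsto_nhds_unique (hΛ _) (((hΛ g).add (hΛ g')).congr fun i => ?_)
        rw [← integral_add ((ν i).integrable g) ((ν i).integrable g')]
        rfl
      map_smul' := fun c g => by
        refine tendsto_nhds_unique (hΛ _) (((hΛ g).const_mul c).congr fun i => ?_)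
        rw [← integral_const_mul]
        rfl }
  let : MeasurableSpace X := borel X
  have : BorelSpace X := ⟨rfl⟩
  obtain ⟨π, hπ, hπr, hπΛ⟩ := exists_measure_of_tight_functional L
    (fun g hg => ge_of_tendsto' (hΛ g) fun i => integral_nonneg hg)
    (tendsto_nhds_unique (hΛ _) (tendsto_const_nhds.congr fun i =>
      ((ν i).integral_const 1).symm))
    (fun ε hε => by
      obtain ⟨K, hK, h⟩ := htight ε hε
      exact ⟨K, hK, fun g h0 h1 hg => le_of_tendsto' (hΛ g) fun i =>
        (ν i).integral_le_of_eq_zero_on hK hε.le (h i) h0 h1 hg⟩)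
  exact ⟨⟨π, hπ, hπr⟩, fun g => (hπΛ g) ▸ hΛ g⟩

section Semicontinuity

variable {X : Type*} [TopologicalSpace X] {d : X → X → ℝ≥0∞} [τW : TopologicalSpace (RadonProb X)]

theorem continuous_dualValue (hnarrow : τW ≤ narrowTopology X) (ν : RadonProb X)
    (q : (X →ᵇ ℝ) × (X →ᵇ ℝ)) : Continuous fun μ : RadonProb X => dualValue μ ν q := by
  have h : Continuous fun μ : RadonProb X => ∫ x, q.1 x ∂μ.toMeasure :=
    continuous_le_dom hnarrow (continuous_iInf_dom (i := q.1) continuous_induced_dom)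
  exact h.add continuous_const

theorem lowerSemicontinuous_wassersteinSq (hd : IsExtendedMetricTopological d)
    (hnarrow : τW ≤ narrowTopology X) (ν : RadonProb X) :
    LowerSemicontinuous fun μ : RadonProb X => wassersteinSq d μ ν := by
  simp_rw [wassersteinSq_eq_iSup_dualValue hd]
  exact lowerSemicontinuous_iSup fun q =>
    (ENNReal.continuous_ofReal.comp (continuous_dualValue hnarrow ν q.1)).lowerSemicontinuous

theorem measurable_wassersteinSq [MeasurableSpace (RadonProb X)] [BorelSpace (RadonProb X)]
    (hd : IsExtendedMetricTopological d) (hnarrow : τW ≤ narrowTopology X) (ν : RadonProb X) :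
    Measurable fun μ : RadonProb X => wassersteinSq d μ ν :=
  (lowerSemicontinuous_wassersteinSq hd hnarrow ν).measurable

/-- Semicontinuity of `(Ω, ν) ↦ ∫ W₂²(μ, ν) dΩ(μ)`, narrow in `ν` and setwise in `Ω`. -/
theorem lintegral_wassersteinSq_le_of_tendsto [T2Space (RadonProb X)]
    [MeasurableSpace (RadonProb X)] [BorelSpace (RadonProb X)]
    (hd : IsExtendedMetricTopological d) (hnarrow : τW ≤ narrowTopology X)
    {Ω : Measure (RadonProb X)} [IsProbabilityMeasure Ω] [Ω.InnerRegular]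
    {I : Type*} {F : Filter I} [F.NeBot] {Ω' : I → Measure (RadonProb X)}
    (hprob : ∀ i, IsProbabilityMeasure (Ω' i)) {ν : I → RadonProb X} {ν' : RadonProb X}
    (hν : ∀ g : X →ᵇ ℝ,
      Tendsto (fun i => ∫ x, g x ∂(ν i).toMeasure) F (𝓝 (∫ x, g x ∂ν'.toMeasure)))
    (hΩ : ∀ h : RadonProb X → ℝ≥0∞, Measurable h → ∫⁻ μ, h μ ∂Ω < ∞ → ∀ ε : ℝ, 0 < ε →
      ∀ᶠ i in F, ∫⁻ μ, h μ ∂Ω' i ≤ ∫⁻ μ, h μ ∂Ω + ENNReal.ofReal ε)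
    {c : ℝ≥0∞} (hc : ∀ᶠ i in F, ∫⁻ μ, wassersteinSq d μ (ν i) ∂Ω' i ≤ c) :
    ∫⁻ μ, wassersteinSq d μ ν' ∂Ω ≤ c := by
  have hsup : ∀ μ ν : RadonProb X, wassersteinSq d μ ν = ⨆ Φ : Finset (dualPairs d),
      Φ.sup fun q => ENNReal.ofReal (dualValue μ ν q) := fun μ ν => by
    rw [wassersteinSq_eq_iSup_dualValue hd, iSup_eq_iSup_finset]
    simp_rw [Finset.sup_eq_iSup]
  simp_rw [hsup _ ν']
  have hcont : ∀ Φ : Finset (dualPairs d), Continuous fun μ : RadonProb X =>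
      Φ.sup fun q => ENNReal.ofReal (dualValue μ ν' q) := fun Φ =>
    Continuous.finset_sup_apply fun q _ =>
      ENNReal.continuous_ofReal.comp (continuous_dualValue hnarrow ν' q.1)
  refine lintegral_iSup_le_of_directed Ω _ (fun Φ => (hcont Φ).lowerSemicontinuous)
    (Monotone.directed_le fun Φ Ψ h μ => Finset.sup_mono h) fun Φ => ?_
  refine ENNReal.le_of_forall_pos_le_add fun ε hε _ => ?_
  set f : RadonProb X → ℝ≥0∞ := fun μ => Φ.sup fun q => ENNReal.ofReal (dualValue μ ν' q) with hf
  have hfm : Measurable f := (hcont Φ).measurable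
  set B : ℝ≥0∞ := Φ.sup fun q => ENNReal.ofReal (‖q.1.1‖ + ‖q.1.2‖) with hB
  have hBtop : B < ∞ := (Finset.sup_lt_iff ENNReal.coe_lt_top).2 fun q _ => ENNReal.ofReal_lt_top
  have hbound : ∀ (μ : RadonProb X) (g : X →ᵇ ℝ), ∫ x, g x ∂μ.toMeasure ≤ ‖g‖ := fun μ g => by
    have := μ.isProbabilityMeasure
    refine (le_abs_self _).trans ?_
    simpa using norm_integral_le_of_norm_le_const (μ := μ.toMeasure)
      (ae_of_all _ fun x => g.norm_coe_le_norm x)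
  have hfB : ∀ μ, f μ ≤ B := fun μ => Finset.sup_mono_fun fun q _ =>
    ENNReal.ofReal_le_ofReal (add_le_add (hbound _ _) (hbound _ _))
  -- The hypothesis on `Ω'` gives only upper bounds; applied to `B - f` it bounds the integral of
  -- `f` from below.
  have hsplit : ∀ (Ω₁ : Measure (RadonProb X)) [IsProbabilityMeasure Ω₁],
      ∫⁻ μ, f μ ∂Ω₁ + ∫⁻ μ, (B - f μ) ∂Ω₁ = B := fun Ω₁ _ => by
    rw [← lintegral_add_left hfm]
    simp_rw [add_tsub_cancel_of_le (hfB _)]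
    simp
  have hfin : ∫⁻ μ, (B - f μ) ∂Ω < ∞ :=
    lt_of_le_of_lt (le_add_self.trans (hsplit Ω).le) hBtop
  have hε2 : (0 : ℝ) < ε / 2 := by positivity
  -- Only the second potential sees `ν`, so the estimate is uniform in `μ`.
  have hev : ∀ᶠ i in F, ∀ q ∈ Φ, ∫ x, q.1.2 x ∂ν'.toMeasure ≤
      ∫ x, q.1.2 x ∂(ν i).toMeasure + ε / 2 := by
    refine (Finset.eventually_all Φ).2 fun q _ => ?_
    filter_upwards [(hν q.1.2).eventually (lt_mem_nhds (sub_lt_self _ hε2))] with i hi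
    linarith
  obtain ⟨i, h1, h2, h3⟩ := (hev.and ((hΩ _ (measurable_const.sub hfm) hfin _ hε2).and hc)).exists
  have hprobi := hprob i
  have hle : ∀ μ, f μ ≤ wassersteinSq d μ (ν i) + ENNReal.ofReal (ε / 2) := fun μ => by
    refine Finset.sup_le fun q hq => ?_
    calc ENNReal.ofReal (dualValue μ ν' q) ≤ ENNReal.ofReal (dualValue μ (ν i) q + ε / 2) := by
          refine ENNReal.ofReal_le_ofReal ?_
          have := h1 q hq
          simp only [dualValue]
          linarith
      _ ≤ ENNReal.ofReal (dualValue μ (ν i) q) + ENNReal.ofReal (ε / 2) := ENNReal.ofReal_add_le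
      _ ≤ _ := add_le_add (dualValue_le_wassersteinSq μ (ν i) q.2) le_rfl
  have h4 : ∫⁻ μ, f μ ∂Ω' i ≤ c + ENNReal.ofReal (ε / 2) := by
    refine (lintegral_mono hle).trans ?_
    rw [lintegral_add_right _ measurable_const, lintegral_const, measure_univ, mul_one]
    exact add_le_add h3 le_rfl
  have h5 : ∫⁻ μ, f μ ∂Ω + ∫⁻ μ, (B - f μ) ∂Ω ≤
      (c + ENNReal.ofReal (ε / 2) + ENNReal.ofReal (ε / 2)) + ∫⁻ μ, (B - f μ) ∂Ω := by
    have h2 : ∫⁻ μ, (B - f μ) ∂Ω' i ≤ ∫⁻ μ, (B - f μ) ∂Ω + ENNReal.ofReal (ε / 2) := h2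
    refine (hsplit Ω).le.trans ((hsplit (Ω' i)).ge.trans ((add_le_add h4 h2).trans (le_of_eq ?_)))
    ring
  have h6 := (ENNReal.add_le_add_iff_right hfin.ne).1 h5
  rw [add_assoc, ← ENNReal.ofReal_add hε2.le hε2.le, add_halves] at h6
  simpa using h6

end Semicontinuity

/-! ### Second moments -/

theorem dist_sq_le {X : Type*} {d : X → X → ℝ≥0∞} (hd : IsExtendedMetric d) (x y z : X) :
    d x z ^ 2 ≤ 2 * d x y ^ 2 + 2 * d y z ^ 2 := by
  calc d x z ^ 2 ≤ (d x y + d y z) ^ 2 := by gcongr; exact hd.triangle x y z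
    _ ≤ 2 * d x y ^ 2 + 2 * d y z ^ 2 := by
        generalize d x y = a
        generalize d y z = b
        induction a with
        | top => simp
        | coe a =>
          induction b with
          | top => simp
          | coe b =>
            norm_cast
            rw [← mul_add]
            exact add_sq_le

theorem measurable_dist_sq_borel {X : Type*} [TopologicalSpace X] {d : X → X → ℝ≥0∞}
    (hd : IsExtendedMetricTopological d) (x₀ : X) :
    @Measurable X ℝ≥0∞ (borel X) _ fun x => d x₀ x ^ 2 := by
  let : MeasurableSpace X := borel X
  have : BorelSpace X := ⟨rfl⟩
  have h : LowerSemicontinuous fun x => d x₀ x ^ 2 :=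
    (lowerSemicontinuous_dist_sq hd).comp (g := fun x : X => (x₀, x)) (by fun_prop)
  exact h.measurable

/-- The squared triangle inequality is integrated against an arbitrary plan. -/
theorem lintegral_dist_sq_snd_le {X : Type*} [TopologicalSpace X] {d : X → X → ℝ≥0∞}
    (hd : IsExtendedMetricTopological d) (x₀ : X) (μ ν : RadonProb X) :
    ∫⁻ y, d x₀ y ^ 2 ∂ν.toMeasure ≤
      2 * wassersteinSq d μ ν + 2 * ∫⁻ x, d x₀ x ^ 2 ∂μ.toMeasure := by
  let : MeasurableSpace X := borel X
  let : MeasurableSpace (X × X) := borel (X × X)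
  have hm := measurable_dist_sq_borel hd x₀
  simp_rw [wassersteinSq, ENNReal.mul_iInf_of_ne two_ne_zero ENNReal.ofNat_ne_top,
    ENNReal.iInf_add]
  refine le_iInf₂ fun π hπ => ?_
  have hm2 : Measurable fun p : X × X => 2 * d x₀ p.1 ^ 2 :=
    (hm.comp measurable_fst_borel).const_mul 2
  rw [← hπ.1, ← hπ.2, lintegral_map hm measurable_fst_borel, lintegral_map hm measurable_snd_borel,
    ← lintegral_const_mul' _ _ ENNReal.ofNat_ne_top,
    ← lintegral_const_mul' _ _ ENNReal.ofNat_ne_top,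
    ← lintegral_add_right _ hm2]
  refine lintegral_mono fun p => ?_
  rw [add_comm]
  exact dist_sq_le hd.isExtendedMetric _ _ _

theorem lintegral_dist_sq_fst_le {X : Type*} [TopologicalSpace X] {d : X → X → ℝ≥0∞}
    (hd : IsExtendedMetricTopological d) (x₀ : X) (μ ν : RadonProb X) :
    ∫⁻ x, d x₀ x ^ 2 ∂μ.toMeasure ≤
      2 * wassersteinSq d μ ν + 2 * ∫⁻ y, d x₀ y ^ 2 ∂ν.toMeasure := by
  let : MeasurableSpace X := borel X
  let : MeasurableSpace (X × X) := borel (X × X)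
  have hm := measurable_dist_sq_borel hd x₀
  simp_rw [wassersteinSq, ENNReal.mul_iInf_of_ne two_ne_zero ENNReal.ofNat_ne_top,
    ENNReal.iInf_add]
  refine le_iInf₂ fun π hπ => ?_
  have hm2 : Measurable fun p : X × X => 2 * d x₀ p.2 ^ 2 :=
    (hm.comp measurable_snd_borel).const_mul 2
  rw [← hπ.1, ← hπ.2, lintegral_map hm measurable_fst_borel, lintegral_map hm measurable_snd_borel,
    ← lintegral_const_mul' _ _ ENNReal.ofNat_ne_top,
    ← lintegral_const_mul' _ _ ENNReal.ofNat_ne_top,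
    ← lintegral_add_right _ hm2]
  refine lintegral_mono fun p => ?_
  rw [add_comm, hd.isExtendedMetric.symm p.1 p.2]
  exact dist_sq_le hd.isExtendedMetric _ _ _

/-! ### Existence of barycenters -/

theorem extIntegral_le {α : Type*} [MeasurableSpace α] {ν : Measure α} {g : α → EReal} {a : ℝ}
    (ha : 0 ≤ a) (h : ∫⁻ x, (g x).toENNReal ∂ν ≤ ENNReal.ofReal a) : extIntegral ν g ≤ a := by
  rw [extIntegral, if_neg (h.trans_lt ENNReal.ofReal_lt_top).ne]
  calc _ ≤ ((∫⁻ x, (g x).toENNReal ∂ν : ℝ≥0∞) : EReal) - 0 :=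
        EReal.sub_le_sub le_rfl (EReal.coe_ennreal_nonneg _)
    _ ≤ ((ENNReal.ofReal a : ℝ≥0∞) : EReal) := by
        rw [sub_zero]
        exact EReal.coe_ennreal_le_coe_ennreal_iff.2 h
    _ = a := by rw [EReal.coe_ennreal_ofReal, max_eq_left ha]

/-- A potential with integrable exponential weight whose integrals are controlled by the transport
cost to measures close to `Ω`. -/
theorem exists_potential {X : Type*} [TopologicalSpace X] {d : X → X → ℝ≥0∞}
    {m : @Measure X (borel X)} (hd : IsExtendedMetricTopological d)
    [τW : TopologicalSpace (RadonProb X)] [MeasurableSpace (RadonProb X)] [BorelSpace (RadonProb X)]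
    (hnarrow : τW ≤ narrowTopology X) {Ω : Measure (RadonProb X)} [IsProbabilityMeasure Ω]
    (hcase : (ExpVolumeGrowth d m ∧ ∀ᵐ μ ∂Ω, μ ∈ radonProbTwo d) ∨
      @IsProbabilityMeasure X (borel X) m)
    {ν₀ : RadonProb X} (hν₀ : ∫⁻ μ, wassersteinSq d μ ν₀ ∂Ω < ∞) :
    ∃ V : X → ℝ≥0∞, @Measurable X _ (borel X) _ V ∧ ∫⁻ x, expWeight V x ∂m < ∞ ∧
      ∃ a b : ℝ≥0∞, a < ∞ ∧ b < ∞ ∧ ∀ (Ω' : Measure (RadonProb X)) (ν : RadonProb X),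
        IsProbabilityMeasure Ω' →
        ∫⁻ μ, wassersteinSq d μ ν ∂Ω' ≤ ∫⁻ μ, wassersteinSq d μ ν₀ ∂Ω' →
        ∫⁻ x, V x ∂ν.toMeasure ≤ a * ∫⁻ μ, wassersteinSq d μ ν₀ ∂Ω' + b := by
  let : MeasurableSpace X := borel X
  rcases hcase with ⟨hexp, hP2⟩ | hm
  swap
  · refine ⟨fun _ => 0, measurable_const, ?_, 0, 0, by simp, by simp, fun Ω' ν _ _ => by simp⟩
    have : expWeight (fun _ : X => (0 : ℝ≥0∞)) = fun _ => 1 := by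
      funext x; simp [expWeight]
    rw [this]
    simp
  have hWm := measurable_wassersteinSq (d := d) hd hnarrow
  -- One measure with finite second moment at finite distance from `ν₀` fixes a base point about
  -- which `ν₀` has finite second moment.
  obtain ⟨μ₀, ⟨x₀, hx₀⟩, hμ₀⟩ := (hP2.and (ae_lt_top (hWm ν₀) hν₀.ne)).exists
  obtain ⟨c, hc, hint⟩ := hexp x₀
  have hmeas := measurable_dist_sq_borel hd x₀
  have hM₀ : ∫⁻ y, d x₀ y ^ 2 ∂ν₀.toMeasure < ∞ :=
    (lintegral_dist_sq_snd_le hd x₀ μ₀ ν₀).trans_lt (ENNReal.add_lt_top.2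
      ⟨ENNReal.mul_lt_top ENNReal.ofNat_lt_top hμ₀, ENNReal.mul_lt_top ENNReal.ofNat_lt_top hx₀⟩)
  refine ⟨fun x => ENNReal.ofReal c * d x₀ x ^ 2, hmeas.const_mul _, ?_,
    ENNReal.ofReal c * 6, ENNReal.ofReal c * (4 * ∫⁻ y, d x₀ y ^ 2 ∂ν₀.toMeasure),
    ENNReal.mul_lt_top ENNReal.ofReal_lt_top ENNReal.ofNat_lt_top,
    ENNReal.mul_lt_top ENNReal.ofReal_lt_top (ENNReal.mul_lt_top ENNReal.ofNat_lt_top hM₀),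
    fun Ω' ν hΩ' hle => ?_⟩
  · refine lt_of_eq_of_lt (lintegral_congr fun x => ?_) hint
    have hc0 : ENNReal.ofReal c ≠ 0 := by simpa using hc
    by_cases hx : d x₀ x = ∞
    · rw [expWeight, if_pos hx, if_pos]
      rw [hx, ENNReal.top_pow two_ne_zero, ENNReal.mul_top hc0]
    · rw [expWeight, if_neg hx, if_neg (ENNReal.mul_ne_top ENNReal.ofReal_ne_top
        (ENNReal.pow_ne_top hx)), ENNReal.toReal_mul, ENNReal.toReal_ofReal hc.le,
        ENNReal.toReal_pow, neg_mul]
  -- The moment passes from `ν₀` to `μ` to `ν`. Averaging over `Ω'` and comparing `ν` with `ν₀`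
  -- gives the factor `2 + 4 = 6`.
  · have hpt : ∀ μ : RadonProb X, ∫⁻ y, d x₀ y ^ 2 ∂ν.toMeasure ≤ 2 * wassersteinSq d μ ν +
        (4 * wassersteinSq d μ ν₀ + 4 * ∫⁻ y, d x₀ y ^ 2 ∂ν₀.toMeasure) := fun μ => by
      refine (lintegral_dist_sq_snd_le hd x₀ μ ν).trans (add_le_add le_rfl ?_)
      refine (mul_le_mul' le_rfl (lintegral_dist_sq_fst_le hd x₀ μ ν₀)).trans (le_of_eq ?_)
      ring
    have h1 : ∫⁻ y, d x₀ y ^ 2 ∂ν.toMeasure ≤ ∫⁻ μ, (2 * wassersteinSq d μ ν +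
        (4 * wassersteinSq d μ ν₀ + 4 * ∫⁻ y, d x₀ y ^ 2 ∂ν₀.toMeasure)) ∂Ω' := by
      refine le_trans (le_of_eq ?_) (lintegral_mono hpt)
      simp
    rw [lintegral_add_left ((hWm ν).const_mul 2), lintegral_add_left ((hWm ν₀).const_mul 4),
      lintegral_const_mul _ (hWm ν), lintegral_const_mul _ (hWm ν₀), lintegral_const,
      measure_univ, mul_one] at h1
    rw [lintegral_const_mul _ hmeas, mul_assoc, ← mul_add]
    refine mul_le_mul' le_rfl (h1.trans ?_)
    rw [← add_assoc]
    refine add_le_add ?_ le_rfl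
    calc _ ≤ 2 * ∫⁻ μ, wassersteinSq d μ ν₀ ∂Ω' + 4 * ∫⁻ μ, wassersteinSq d μ ν₀ ∂Ω' :=
          add_le_add (mul_le_mul' le_rfl hle) le_rfl
      _ = _ := by ring

theorem mainTheorem10 {X : Type*} [TopologicalSpace X]
    (d : X → X → ℝ≥0∞) (m : @Measure X (borel X)) (K : ℝ)
    (hX : IsExtendedMetricMeasureSpace d m)
    -- the topology on `𝒫(X)` and its Borel sets
    [τW : TopologicalSpace (RadonProb X)] [MeasurableSpace (RadonProb X)] [BorelSpace (RadonProb X)]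
    (hW : IsExtendedMetricTopological (wasserstein d))
    (hnarrow : τW ≤ narrowTopology X)
    (hBCD : BCD d m K)
    -- `Ω` is a Radon probability measure on `𝒫(X)`
    (Ω : Measure (RadonProb X)) [IsProbabilityMeasure Ω] [Ω.InnerRegular]
    (hVar : wassersteinVar d Ω < ∞)
    (hEnt : extIntegral Ω (relEntropy m) < ⊤)
    (hcase : (ExpVolumeGrowth d m ∧ ∀ᵐ μ ∂Ω, μ ∈ radonProbTwo d) ∨
      @IsProbabilityMeasure X (borel X) m) :
    ∃ ν : RadonProb X, IsWassersteinBarycenter d Ω ν := by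
  classical
  have hd := hX.isExtendedMetricTopological
  have hT35 := hd.t35Space
  have hT2 := hW.t2
  have hWm := measurable_wassersteinSq (d := d) hd hnarrow
  obtain ⟨ν₀, hν₀⟩ := iInf_lt_iff.1 hVar
  have hEntfin : ∫⁻ μ, (relEntropy m μ).toENNReal ∂Ω ≠ ∞ := fun htop => by
    rw [extIntegral, if_pos htop] at hEnt
    exact lt_irrefl _ hEnt
  -- The entropy enters through a measurable `g`, so its own measurability is not needed; the
  -- approximations are placed where it is at most `g + 1`.
  obtain ⟨g, hgm, hgfin, hgA⟩ := exists_measurable_minorant hEntfin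
  obtain ⟨V, hVm, hZ, a, b, ha, hb, hV⟩ := exists_potential (m := m) hd hnarrow hcase hν₀
  set w₀ : RadonProb X → ℝ≥0∞ := fun μ => wassersteinSq d μ ν₀ with hw₀
  -- finitely supported approximations, indexed by finitely many test functions and an error
  let tests : Finset (RadonProb X → ℝ≥0∞) → Finset (RadonProb X → ℝ≥0∞) := fun s =>
    insert g (insert w₀ (s.filter fun h => Measurable h ∧ ∫⁻ μ, h μ ∂Ω < ∞))
  have happrox : ∀ i : Finset (RadonProb X → ℝ≥0∞) × ℕ, ∃ Ω' : Measure (RadonProb X),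
      IsProbabilityMeasure Ω' ∧ (∃ S : Set (RadonProb X), S.Finite ∧ Ω' Sᶜ = 0) ∧
      Ω' {μ | (relEntropy m μ).toENNReal ≤ g μ + 1}ᶜ = 0 ∧
      ∀ h ∈ tests i.1, ∫⁻ μ, h μ ∂Ω' ≤ ∫⁻ μ, h μ ∂Ω + ENNReal.ofReal (1 / (i.2 + 1)) := fun i => by
    refine exists_finite_average Ω hgA (tests i.1) (fun h hh => ?_) (by positivity)
    simp only [tests, Finset.mem_insert, Finset.mem_filter] at hh
    rcases hh with rfl | rfl | hh
    · exact ⟨hgm, hgfin⟩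
    · exact ⟨hWm ν₀, hν₀⟩
    · exact hh.2
  choose Ω' hprob hfinite hA htests using happrox
  have hone : ∀ n : ℕ, ENNReal.ofReal (1 / ((n : ℝ) + 1)) ≤ 1 := fun n => by
    rw [ENNReal.ofReal_le_one, div_le_one (by positivity)]
    linarith [n.cast_nonneg (α := ℝ)]
  have hw₀' : ∀ i, ∫⁻ μ, w₀ μ ∂Ω' i ≤ ∫⁻ μ, w₀ μ ∂Ω + 1 := fun i =>
    (htests i w₀ (by simp [tests])).trans (add_le_add le_rfl (hone _))
  have hw₀fin : ∫⁻ μ, w₀ μ ∂Ω + 1 < ∞ := ENNReal.add_lt_top.2 ⟨hν₀, ENNReal.one_lt_top⟩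
  have hvar' : ∀ i, wassersteinVar d (Ω' i) ≤ ∫⁻ μ, w₀ μ ∂Ω + 1 := fun i =>
    (iInf_le _ ν₀).trans (hw₀' i)
  choose ν hbary hνent using fun i =>
    hBCD (Ω' i) (hprob i) (hfinite i) ((hvar' i).trans_lt hw₀fin)
  -- uniform bounds for the barycenters of the approximations
  set C₁ : ℝ := (∫⁻ μ, g μ ∂Ω + 1 + 1).toReal with hC₁
  have hC₁fin : ∫⁻ μ, g μ ∂Ω + 1 + 1 ≠ ∞ := by simp [hgfin.ne]
  have hent₁ : ∀ i, extIntegral (Ω' i) (relEntropy m) ≤ C₁ := fun i => by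
    have hpi := hprob i
    refine extIntegral_le ENNReal.toReal_nonneg ?_
    rw [ENNReal.ofReal_toReal hC₁fin]
    calc ∫⁻ μ, (relEntropy m μ).toENNReal ∂Ω' i ≤ ∫⁻ μ, (g μ + 1) ∂Ω' i := by
          refine lintegral_mono_ae ?_
          filter_upwards [measure_eq_zero_iff_ae_notMem.1 (hA i)] with μ hμ
          exact not_not.1 hμ
      _ = ∫⁻ μ, g μ ∂Ω' i + 1 := by
          rw [lintegral_add_left hgm, lintegral_const, measure_univ, mul_one]
      _ ≤ _ := add_le_add ((htests i g (by simp [tests])).trans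
          (add_le_add le_rfl (hone _))) le_rfl
  -- The absolute value covers negative `K`, for which the variance term increases the entropy
  -- bound.
  set C₂ : ℝ := |K| / 2 * (∫⁻ μ, w₀ μ ∂Ω + 1).toReal with hC₂
  have hent : ∀ i, relEntropy m (ν i) ≤ ((C₁ + C₂ : ℝ) : EReal) := fun i => by
    refine (hνent i).trans ((EReal.sub_le_sub (hent₁ i) le_rfl).trans ?_)
    rw [← EReal.coe_sub, EReal.coe_le_coe_iff]
    have h1 : (wassersteinVar d (Ω' i)).toReal ≤ (∫⁻ μ, w₀ μ ∂Ω + 1).toReal :=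
      ENNReal.toReal_mono hw₀fin.ne (hvar' i)
    have h2 : -(K / 2 * (wassersteinVar d (Ω' i)).toReal) ≤
        |K| / 2 * (wassersteinVar d (Ω' i)).toReal := by
      have h3 : 0 ≤ (wassersteinVar d (Ω' i)).toReal := ENNReal.toReal_nonneg
      have h4 : -K * (wassersteinVar d (Ω' i)).toReal ≤ |K| * (wassersteinVar d (Ω' i)).toReal :=
        mul_le_mul_of_nonneg_right (neg_le_abs K) h3
      linarith
    have h5 : |K| / 2 * (wassersteinVar d (Ω' i)).toReal ≤ C₂ := by
      rw [hC₂]; gcongr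
    linarith
  have hMfin : a * (∫⁻ μ, w₀ μ ∂Ω + 1) + b ≠ ∞ :=
    (ENNReal.add_lt_top.2 ⟨ENNReal.mul_lt_top ha hw₀fin, hb⟩).ne
  have hmoment : ∀ i, ∫⁻ x, V x ∂(ν i).toMeasure ≤
      ENNReal.ofReal (a * (∫⁻ μ, w₀ μ ∂Ω + 1) + b).toReal := fun i => by
    rw [ENNReal.ofReal_toReal hMfin]
    exact (hV (Ω' i) (ν i) (hprob i) (hbary i ν₀)).trans
      (add_le_add (mul_le_mul' le_rfl (hw₀' i)) le_rfl)
  -- compactness and semicontinuity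
  let F : Ultrafilter (Finset (RadonProb X → ℝ≥0∞) × ℕ) := Ultrafilter.of atTop
  have hF : (F : Filter (Finset (RadonProb X → ℝ≥0∞) × ℕ)) ≤ atTop := Ultrafilter.of_le _
  obtain ⟨ν', hν'⟩ := exists_narrow_limit ν F fun ε hε => by
    obtain ⟨Q, hQ, h⟩ := exists_isCompact_of_relEntropy_le hX.innerRegular hVm hZ
      (C := C₁ + C₂) (M := (a * (∫⁻ μ, w₀ μ ∂Ω + 1) + b).toReal)
      (by positivity) ENNReal.toReal_nonneg hε
    exact ⟨Q, hQ, fun i => h (ν i) (hmoment i) (hent i)⟩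
  have hconv : ∀ h : RadonProb X → ℝ≥0∞, Measurable h → ∫⁻ μ, h μ ∂Ω < ∞ → ∀ ε : ℝ, 0 < ε →
      ∀ᶠ i in (F : Filter (Finset (RadonProb X → ℝ≥0∞) × ℕ)),
        ∫⁻ μ, h μ ∂Ω' i ≤ ∫⁻ μ, h μ ∂Ω + ENNReal.ofReal ε := fun h hm hfin ε hε => by
    obtain ⟨n, hn⟩ := exists_nat_one_div_lt hε
    -- Eventually `h` is among the test functions and the error is below `ε`.
    filter_upwards [hF (eventually_ge_atTop ({h}, n))] with i hi
    refine (htests i h ?_).trans (add_le_add le_rfl (ENNReal.ofReal_le_ofReal ?_))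
    · have : h ∈ i.1 := hi.1 (Finset.mem_singleton_self h)
      simp [tests, this, hm, hfin]
    · refine le_trans ?_ hn.le
      have : (n : ℝ) ≤ i.2 := by exact_mod_cast hi.2
      gcongr
  refine ⟨ν', fun ν'' => ?_⟩
  by_cases htop : ∫⁻ μ, wassersteinSq d μ ν'' ∂Ω = ∞
  · rw [htop]; exact le_top
  refine ENNReal.le_of_forall_pos_le_add fun ε hε _ => ?_
  refine lintegral_wassersteinSq_le_of_tendsto hd hnarrow hprob hν' hconv ?_
  -- The cost of the competitor is a test function, and `ν i` does at least as well for `Ω' i`.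
  filter_upwards [hconv _ (hWm ν'') (lt_top_iff_ne_top.2 htop) ε hε] with i hi
  exact (hbary i ν'').trans (by simpa using hi)
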